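/- Let $M$ be a connected, Hausdorff, paracompact smooth ($C^\infty$) manifold of dimension $4$ without boundary, and let $\mathrm{Diff}(M)$ be the group of its smooth diffeomorphisms. Let $\mathcal{B}_g\to M$ be the bundle of Lorentz metrics, whose fiber over $p$ is the set of symmetric bilinear forms of signature $(+,-,-,-)$ on $T_pM$, and, for a given index structure (a finite sequence of upper and lower indices), let $\mathcal{T}\to M$ be the corresponding bundle of tensors. A diffeomorphism $\phi$ of $M$ acts on $\mathcal{B}_g$ and on $\mathcal{T}$ by transport of tensors along its tangent map; write $\phi_g$ and $\phi_{\mathcal{T}}$ for these diffeomorphisms of the total spaces. Let $J^1\mathcal{B}_g$ be the bundle of 1-jets $j^1_p\gamma$ of smooth local sections $\gamma$ of $\mathcal{B}_g$ (two local sections have the same 1-jet at $p$ if and only if their values and their tangent maps at $p$ agree), let $\theta\colon J^1\mathcal{B}_g\to\mathcal{B}_g$, $j^1_p\gamma\mapsto\gamma(p)$, be the projection, and let $\phi$ act on $J^1\mathcal{B}_g$ by $\phi_g^1(j^1_p\gamma)=j^1_{\phi(p)}(\phi_g\circ\gamma\circ\phi^{-1})$. A concomitant from $\mathcal{B}_g$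 to $\mathcal{T}$ is a smooth map $\chi'\colon\mathcal{B}_g\to\mathcal{T}$ with $\chi'\circ\phi_g=\phi_{\mathcal{T}}\circ\chi'$ for all $\phi\in\mathrm{Diff}(M)$. A first-order concomitant from $\mathcal{B}_g$ to $\mathcal{T}$ is a smooth map $\chi\colon J^1\mathcal{B}_g\to\mathcal{T}$ such that (1) $\chi\circ\phi_g^1=\phi_{\mathcal{T}}\circ\chi$ for all $\phi\in\mathrm{Diff}(M)$, and (2) there is no concomitant $\chi'$ from $\mathcal{B}_g$ to $\mathcal{T}$ with $\chi=\chi'\circ\theta$. Then, for every index structure, there is no first-order concomitant from $\mathcal{B}_g$ to $\mathcal{T}$. Consequently every smooth map $\chi\colon J^1\mathcal{B}_g\to\mathcal{T}$ that satisfies (1) depends only on the metric itself: $\chi=\chi'\circ\theta$ for some concomitant $\chi'\colon\mathcal{B}_g\to\mathcal{T}$. -/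

import Mathlib

open scoped Manifold ContDiff Topology Bundle

noncomputable section

namespace Concomitant

theorem mfderiv_symm_comp {E H M : Type*} [NormedAddCommGroup E] [NormedSpace ℝ E]
    [TopologicalSpace H] {I : ModelWithCorners ℝ E H} [TopologicalSpace M] [ChartedSpace H M]
    (φ : M ≃ₘ^∞⟮I, I⟯ M) (x : M) :
    (mfderiv I I φ.symm (φ x)).comp (mfderiv I I φ x) = .id ℝ (TangentSpace I x) := by
  have h := mfderiv_comp x (I := I) (I' := I) (I'' := I)
    ((φ.symm.mdifferentiable (by simp)) (φ x)) ((φ.mdifferentiable (by simp)) x)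
  have h2 : (φ.symm ∘ φ : M → M) = id := by ext; simp
  rw [h2, mfderiv_id] at h
  exact h.symm

section Core

variable {E W : Type*} [NormedAddCommGroup E] [NormedSpace ℝ E]
  [NormedAddCommGroup W] [NormedSpace ℝ W]

variable (E W) in
/-- A smooth representation on `W` of the linear changes of frame of `E`, as carried by a space of
tensors over `E`: `act A A⁻¹` is the action on `W` of the invertible linear map `A : E → E`.  The
inverse is passed as a separate argument, because contravariant slots transform with `A` and
covariant ones with `A⁻¹`. -/
structure TensorialAction where
  act : (E →L[ℝ] E) → (E →L[ℝ] E) → (W →L[ℝ] W)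
  contDiff_act : ContDiff ℝ ∞ (fun p : (E →L[ℝ] E) × (E →L[ℝ] E) => act p.1 p.2)
  act_id : act (.id ℝ E) (.id ℝ E) = .id ℝ W
  act_comp : ∀ A₁ A₂ B₁ B₂, act (A₂ ∘L A₁) (B₁ ∘L B₂) = act A₂ B₂ ∘L act A₁ B₁

namespace TensorialAction

variable {H : Type*} [TopologicalSpace H] (I : ModelWithCorners ℝ E H)
  (M : Type*) [TopologicalSpace M] [ChartedSpace H M] [IsManifold I ∞ M]
  (ρ : TensorialAction E W)

/-- The vector bundle over `M` associated with the tangent bundle of `M` through `ρ`: its coordinate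
changes are the images under `ρ` of those of the tangent bundle. -/
def core : VectorBundleCore ℝ M W (atlas H M) where
  baseSet := (tangentBundleCore I M).baseSet
  isOpen_baseSet := (tangentBundleCore I M).isOpen_baseSet
  indexAt := (tangentBundleCore I M).indexAt
  mem_baseSet_at := (tangentBundleCore I M).mem_baseSet_at
  coordChange i j x := ρ.act ((tangentBundleCore I M).coordChange i j x)
    ((tangentBundleCore I M).coordChange j i x)
  coordChange_self i x hx v := by
    have h : (tangentBundleCore I M).coordChange i i x = .id ℝ E := by
      ext v; exact (tangentBundleCore I M).coordChange_self i x hx v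
    rw [h, ρ.act_id]; rfl
  continuousOn_coordChange i j := by
    refine ρ.contDiff_act.continuous.comp_continuousOn
      (((tangentBundleCore I M).continuousOn_coordChange i j).prodMk ?_)
    rw [Set.inter_comm]
    exact (tangentBundleCore I M).continuousOn_coordChange j i
  coordChange_comp i j k x hx v := by
    have h₁ : (tangentBundleCore I M).coordChange j k x ∘L
        (tangentBundleCore I M).coordChange i j x = (tangentBundleCore I M).coordChange i k x := by
      ext v; exact (tangentBundleCore I M).coordChange_comp i j k x hx v
    have h₂ : (tangentBundleCore I M).coordChange j i x ∘L
        (tangentBundleCore I M).coordChange k j x = (tangentBundleCore I M).coordChange k i x := by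
      ext v
      exact (tangentBundleCore I M).coordChange_comp k j i x ⟨⟨hx.2, hx.1.2⟩, hx.1.1⟩ v
    rw [← h₁, ← h₂, ρ.act_comp]; rfl

instance : (ρ.core I M).IsContMDiff I ∞ where
  contMDiffOn_coordChange i j := by
    have : IsManifold I (∞ + 1) M := inferInstanceAs (IsManifold I ∞ M)
    have : (tangentBundleCore I M).IsContMDiff I ∞ := tangentBundleCore.isContMDiff
    have h₁ := (tangentBundleCore I M).contMDiffOn_coordChange (n := ∞) I i j
    have h₂ := (tangentBundleCore I M).contMDiffOn_coordChange (n := ∞) I j i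
    rw [Set.inter_comm] at h₂
    exact ρ.contDiff_act.contMDiff.comp_contMDiffOn (h₁.prodMk_space h₂)

/-- The total space of the bundle associated with `ρ`.  Its fiber over `x` is, like the tangent
space at `x`, represented in the preferred chart at `x`: since `TangentSpace I x` is `E`, the fiber
is the space of tensors over `TangentSpace I x`. -/
abbrev Total : Type _ := Bundle.TotalSpace W (ρ.core I M).Fiber


variable {I M}

theorem act_conj (C C' A A' D D' : E →L[ℝ] E) (w : W)
    (h : ρ.act D D' (ρ.act D' D w) = w) :
    ρ.act C C' (ρ.act A A' w) =
      ρ.act (C ∘L A ∘L D) ((D' ∘L A') ∘L C') (ρ.act D' D w) := by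
  rw [ρ.act_comp, ρ.act_comp]
  simp only [ContinuousLinearMap.comp_apply, h]

/-- The natural transport of tensors by a diffeomorphism `φ`: a tensor at `x` is sent to a tensor
at `φ x` by the tangent map of `φ` at `x` and its inverse, which is the tangent map of `φ⁻¹` at
`φ x`. -/
def push (φ : M ≃ₘ^∞⟮I, I⟯ M) (u : ρ.Total I M) : ρ.Total I M :=
  ⟨φ u.1, ρ.act (mfderiv I I φ u.1) (mfderiv I I φ.symm (φ u.1)) u.2⟩

theorem push_refl (u : ρ.Total I M) : ρ.push (Diffeomorph.refl I M ∞) u = u := by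
  obtain ⟨x, w⟩ := u
  have h : ρ.act (mfderiv I I (id : M → M) x) (mfderiv I I (id : M → M) x) w = w := by
    rw [mfderiv_id]
    exact DFunLike.congr_fun ρ.act_id w
  exact congrArg (Bundle.TotalSpace.mk (F := W) (E := (ρ.core I M).Fiber) x) h

theorem push_trans (φ ψ : M ≃ₘ^∞⟮I, I⟯ M) (u : ρ.Total I M) :
    ρ.push (φ.trans ψ) u = ρ.push ψ (ρ.push φ u) := by
  obtain ⟨x, w⟩ := u
  have h₁ : mfderiv I I (ψ ∘ φ : M → M) x = _ := mfderiv_comp x (I := I) (I' := I) (I'' := I)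
    ((ψ.mdifferentiable (by simp)) (φ x)) ((φ.mdifferentiable (by simp)) x)
  have h₂ : mfderiv I I (φ.symm ∘ ψ.symm : M → M) (ψ (φ x)) = _ :=
    mfderiv_comp (ψ (φ x)) (I := I) (I' := I) (I'' := I)
    ((φ.symm.mdifferentiable (by simp)) (ψ.symm (ψ (φ x))))
    ((ψ.symm.mdifferentiable (by simp)) (ψ (φ x)))
  rw [ψ.symm_apply_apply] at h₂
  refine congrArg (Bundle.TotalSpace.mk (F := W) (E := (ρ.core I M).Fiber) (ψ (φ x))) ?_
  change ρ.act (mfderiv I I (ψ ∘ φ : M → M) x) (mfderiv I I (φ.symm ∘ ψ.symm : M → M) (ψ (φ x))) w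
    = _
  rw [h₁, h₂]
  exact DFunLike.congr_fun (ρ.act_comp _ _ _ _) w

theorem contMDiff_push (φ : M ≃ₘ^∞⟮I, I⟯ M) :
    ContMDiff (I.prod 𝓘(ℝ, W)) (I.prod 𝓘(ℝ, W)) ∞ (ρ.push φ) := by
  intro u₀
  have hproj : ContMDiff (I.prod 𝓘(ℝ, W)) I ∞ (fun u : ρ.Total I M => u.1) :=
    Bundle.contMDiff_proj _
  refine (Bundle.contMDiffAt_totalSpace).2 ⟨(φ.contMDiff.comp hproj) u₀, ?_⟩
  have hw : ContMDiffAt (I.prod 𝓘(ℝ, W)) 𝓘(ℝ, W) ∞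
      (fun u : ρ.Total I M => (trivializationAt W (ρ.core I M).Fiber u₀.1 u).2) u₀ :=
    ((Bundle.contMDiffAt_totalSpace).1 (contMDiffAt_id (x := u₀))).2
  have hA := (φ.contMDiff.contMDiffAt (x := u₀.1)).mfderiv_const (m := ∞) (n := ∞) (by simp)
  have hB := (φ.symm.contMDiff.contMDiffAt (x := φ u₀.1)).mfderiv_const (m := ∞) (n := ∞) (by simp)
  have hA' := hA.comp u₀ hproj.contMDiffAt
  have hB' := hB.comp u₀ ((φ.contMDiff.comp hproj) u₀)
  have hAB := (ρ.contDiff_act.contMDiff.contMDiffAt).comp u₀ (hA'.prodMk_space hB')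
  refine (hAB.clm_apply hw).congr_of_eventuallyEq ?_
  have e₁ : ∀ᶠ u : ρ.Total I M in 𝓝 u₀, u.1 ∈ (chartAt H u₀.1).source :=
    hproj.continuous.continuousAt.eventually_mem
      ((chartAt H u₀.1).open_source.mem_nhds (mem_chart_source H u₀.1))
  have e₂ : ∀ᶠ u : ρ.Total I M in 𝓝 u₀, φ u.1 ∈ (chartAt H (φ u₀.1)).source :=
    (φ.continuous.comp hproj.continuous).continuousAt.eventually_mem
      ((chartAt H (φ u₀.1)).open_source.mem_nhds (mem_chart_source H (φ u₀.1)))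
  filter_upwards [e₁, e₂] with u h₁ h₂
  have h₁' : φ.symm (φ u.1) ∈ (chartAt H (φ.symm (φ u₀.1))).source := by simpa using h₁
  set T := tangentBundleCore I M with hT
  have k₁ : inTangentCoordinates I I id φ (mfderiv I I φ) u₀.1 u.1 =
      T.coordChange (achart H (φ u.1)) (achart H (φ u₀.1)) (φ u.1) ∘L mfderiv I I φ u.1 ∘L
        T.coordChange (achart H u₀.1) (achart H u.1) u.1 :=
    inTangentCoordinates_eq (I := I) (I' := I) id φ (mfderiv I I φ) (x₀ := u₀.1) (x := u.1) h₁ h₂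
  have k₂ : inTangentCoordinates I I id φ.symm (mfderiv I I φ.symm) (φ u₀.1) (φ u.1) =
      (T.coordChange (achart H u.1) (achart H u₀.1) u.1 ∘L mfderiv I I φ.symm (φ u.1)) ∘L
        T.coordChange (achart H (φ u₀.1)) (achart H (φ u.1)) (φ u.1) := by
    have := inTangentCoordinates_eq (I := I) (I' := I) id φ.symm (mfderiv I I φ.symm)
      (x₀ := φ u₀.1) (x := φ u.1) h₂ h₁'
    rw [φ.symm_apply_apply, φ.symm_apply_apply] at this
    exact this
  have k₃ : ∀ v : W, ρ.act (T.coordChange (achart H u₀.1) (achart H u.1) u.1)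
      (T.coordChange (achart H u.1) (achart H u₀.1) u.1)
      (ρ.act (T.coordChange (achart H u.1) (achart H u₀.1) u.1)
        (T.coordChange (achart H u₀.1) (achart H u.1) u.1) v) = v := fun v => by
    have h := (ρ.core I M).coordChange_comp (achart H u.1) (achart H u₀.1) (achart H u.1) u.1
      ⟨⟨mem_chart_source H u.1, h₁⟩, mem_chart_source H u.1⟩ v
    rw [(ρ.core I M).coordChange_self _ _ (mem_chart_source H u.1)] at h
    exact h
  change ρ.act (T.coordChange (achart H (φ u.1)) (achart H (φ u₀.1)) (φ u.1))
      (T.coordChange (achart H (φ u₀.1)) (achart H (φ u.1)) (φ u.1))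
      (ρ.act (mfderiv I I φ u.1) (mfderiv I I φ.symm (φ u.1)) u.2) =
    ρ.act (inTangentCoordinates I I id φ (mfderiv I I φ) u₀.1 u.1)
      (inTangentCoordinates I I id φ.symm (mfderiv I I φ.symm) (φ u₀.1) (φ u.1))
      (ρ.act (T.coordChange (achart H u.1) (achart H u₀.1) u.1)
        (T.coordChange (achart H u₀.1) (achart H u.1) u.1) u.2)
  rw [k₁, k₂]
  exact ρ.act_conj _ _ _ _ _ _ _ (k₃ u.2)

/-- The natural transport of tensors by a diffeomorphism of `M`, as a diffeomorphism of the total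
space of the bundle. -/
def induced (φ : M ≃ₘ^∞⟮I, I⟯ M) :
    ρ.Total I M ≃ₘ^∞⟮I.prod 𝓘(ℝ, W), I.prod 𝓘(ℝ, W)⟯ ρ.Total I M where
  toFun := ρ.push φ
  invFun := ρ.push φ.symm
  left_inv u := by rw [← push_trans, φ.self_trans_symm, push_refl]
  right_inv u := by rw [← push_trans, φ.symm_trans_self, push_refl]
  contMDiff_toFun := ρ.contMDiff_push φ
  contMDiff_invFun := ρ.contMDiff_push φ.symm


end TensorialAction
end Core

section Jets

variable {EM HM M EB HB B : Type*}
  [NormedAddCommGroup EM] [NormedSpace ℝ EM] [TopologicalSpace HM]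
  {I : ModelWithCorners ℝ EM HM} [TopologicalSpace M] [ChartedSpace HM M]
  [NormedAddCommGroup EB] [NormedSpace ℝ EB] [TopologicalSpace HB]
  {J : ModelWithCorners ℝ EB HB} [TopologicalSpace B] [ChartedSpace HB B]

/-- An induction for a bundle `pr : B → M`: an injective homomorphism from the group of
diffeomorphisms of `M` to the group of those diffeomorphisms of `B` that are strongly consistent
with the underlying diffeomorphism of `M`. -/
structure Induction (pr : C^∞⟮J, B; I, M⟯) where
  toFun : (M ≃ₘ^∞⟮I, I⟯ M) → (B ≃ₘ^∞⟮J, J⟯ B)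
  consistent : ∀ φ u, pr (toFun φ u) = φ (pr u)
  strongly_consistent : ∀ (φ : M ≃ₘ^∞⟮I, I⟯ M) (O : Set M), IsOpen O → (∀ x ∈ O, φ x = x) →
    ∀ u, pr u ∈ O → toFun φ u = u
  map_refl : toFun (.refl I M ∞) = .refl J B ∞
  map_trans : ∀ φ ψ, toFun (φ.trans ψ) = (toFun φ).trans (toFun ψ)
  injective : Function.Injective toFun

instance (pr : C^∞⟮J, B; I, M⟯) :
    CoeFun (Induction pr) fun _ => (M ≃ₘ^∞⟮I, I⟯ M) → (B ≃ₘ^∞⟮J, J⟯ B) := ⟨Induction.toFun⟩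

/-- The additive group structure of the fibers of the pullback `pr* TM`. -/
instance (pr : C^∞⟮J, B; I, M⟯) (b : B) :
    AddCommGroup (((pr : B → M) *ᵖ (TangentSpace I : M → Type _)) b) :=
  inferInstanceAs (AddCommGroup (TangentSpace I (pr b)))

/-- The total space of the vector bundle over `B` with fiber `Hom(T_{pr b} M, T_b B)` over `b`, with
its Mathlib topology and smooth structure.  It holds the 1-jets of sections of `pr`. -/
abbrev JetAmbient (pr : C^∞⟮J, B; I, M⟯) : Type _ :=
  Bundle.TotalSpace (EM →L[ℝ] EB) (fun b : B =>
    ((pr : B → M) *ᵖ (TangentSpace I : M → Type _)) b →L[ℝ] TangentSpace J b)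

variable {pr : C^∞⟮J, B; I, M⟯}

/-- `γ` is a smooth section of the bundle `pr` on a neighborhood of `p`. -/
def IsLocalSection (pr : C^∞⟮J, B; I, M⟯) (γ : M → B) (p : M) : Prop :=
  ∀ᶠ q in 𝓝 p, ContMDiffAt I J ∞ γ q ∧ pr (γ q) = q

/-- The 1-jet at `p` of a local section `γ`, that is, the pair of its value `γ p` and its tangent map
`T_p M → T_{γ p} B`: two local sections have the same 1-jet at `p` if and only if their values and
their tangent maps at `p` agree. -/
def jet (pr : C^∞⟮J, B; I, M⟯) (γ : M → B) (p : M) : JetAmbient pr :=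
  ⟨γ p, (mfderiv I J γ p : EM →L[ℝ] EB)⟩

/-- The set of all 1-jets of local sections of `pr`. -/
def jetSet (pr : C^∞⟮J, B; I, M⟯) : Set (JetAmbient pr) :=
  {u | ∃ γ p, IsLocalSection pr γ p ∧ u = jet pr γ p}

/-- The first jet bundle `J¹B`. -/
abbrev Jet1 (pr : C^∞⟮J, B; I, M⟯) : Type _ := jetSet pr

/-- The projection `J¹B → B` to the value of the section. -/
def Jet1.truncate (u : Jet1 pr) : B := u.1.1

/-- The first prolongation of an induction, on `Hom(T_{pr b} M, T_b B)`:
`L ↦ T(ι φ) ∘ L ∘ T(φ⁻¹)`. -/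
def Induction.prolongAmbient (ι : Induction pr) (φ : M ≃ₘ^∞⟮I, I⟯ M) (u : JetAmbient pr) :
    JetAmbient pr :=
  ⟨ι φ u.1, ((mfderiv J J (ι φ) u.1 : EB →L[ℝ] EB).comp ((u.2 : EM →L[ℝ] EB).comp
    (mfderiv I I φ.symm (φ (pr u.1)) : EM →L[ℝ] EM)) : EM →L[ℝ] EB)⟩

theorem IsLocalSection.induced (ι : Induction pr) (φ : M ≃ₘ^∞⟮I, I⟯ M) {γ : M → B} {p : M}
    (h : IsLocalSection pr γ p) : IsLocalSection pr (ι φ ∘ γ ∘ φ.symm) (φ p) := by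
  have hc : Filter.Tendsto φ.symm (𝓝 (φ p)) (𝓝 p) := by
    simpa using φ.symm.continuous.tendsto (φ p)
  refine (hc.eventually h).mono fun q hq => ⟨?_, ?_⟩
  · exact (ι φ).contMDiff.contMDiffAt.comp q (hq.1.comp q φ.symm.contMDiff.contMDiffAt)
  · simp [ι.consistent, hq.2]

/-- The prolongation of `φ` sends the 1-jet of `γ` at `p` to the 1-jet of `ι φ ∘ γ ∘ φ⁻¹` at `φ p`. -/
theorem Induction.prolongAmbient_jet (ι : Induction pr) (φ : M ≃ₘ^∞⟮I, I⟯ M) {γ : M → B} {p : M}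
    (h : IsLocalSection pr γ p) :
    ι.prolongAmbient φ (jet pr γ p) = jet pr (ι φ ∘ γ ∘ φ.symm) (φ p) := by
  obtain ⟨hγ, hp⟩ := h.self_of_nhds
  have e : φ.symm (φ p) = p := φ.symm_apply_apply p
  have d₁ : HasMFDerivAt I I φ.symm (φ p) (mfderiv I I φ.symm (φ p)) :=
    ((φ.symm.mdifferentiable (by simp)) (φ p)).hasMFDerivAt
  have d₂ : HasMFDerivAt I J γ (φ.symm (φ p)) (mfderiv I J γ (φ.symm (φ p))) := by
    rw [e]; exact (hγ.mdifferentiableAt (by simp)).hasMFDerivAt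
  have d₃ : HasMFDerivAt J J (ι φ) (γ (φ.symm (φ p))) (mfderiv J J (ι φ) (γ (φ.symm (φ p)))) :=
    (((ι φ).mdifferentiable (by simp)) _).hasMFDerivAt
  have d := (d₃.comp (φ p) (d₂.comp (φ p) d₁)).mfderiv
  have key : ∀ (q : M) (L : EM →L[ℝ] EB), q = p → pr (γ p) = p →
      L = ((mfderiv J J (ι φ) (γ q) : EB →L[ℝ] EB).comp ((mfderiv I J γ q : EM →L[ℝ] EB).comp
        (mfderiv I I φ.symm (φ p) : EM →L[ℝ] EM)) : EM →L[ℝ] EB) →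
      ι.prolongAmbient φ (jet pr γ p) = ⟨ι φ (γ q), L⟩ := by
    rintro q L rfl hq rfl
    have hc : ∀ x y : M, x = y → (mfderiv I I φ.symm (φ x) : EM →L[ℝ] EM) =
        (mfderiv I I φ.symm (φ y) : EM →L[ℝ] EM) := by rintro x y rfl; rfl
    exact congrArg (fun T : EM →L[ℝ] EM => (⟨ι φ (γ q), ((mfderiv J J (ι φ) (γ q) :
      EB →L[ℝ] EB).comp ((mfderiv I J γ q : EM →L[ℝ] EB).comp T) : EM →L[ℝ] EB)⟩ :
        JetAmbient pr)) (hc _ _ hq)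
  exact key _ _ e hp d

/-- The first prolongation of an induction, as an action on the jet bundle `J¹B`. -/
def Induction.prolong (ι : Induction pr) (φ : M ≃ₘ^∞⟮I, I⟯ M) (u : Jet1 pr) : Jet1 pr :=
  ⟨ι.prolongAmbient φ u.1, by
    obtain ⟨γ, p, h, hu⟩ := u.2
    exact ⟨_, _, h.induced ι φ, by rw [hu, ι.prolongAmbient_jet φ h]⟩⟩

end Jets

section Smooth

variable {EX HX X EN HN N : Type*}
  [NormedAddCommGroup EX] [NormedSpace ℝ EX] [TopologicalSpace HX]
  [TopologicalSpace X] [ChartedSpace HX X]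
  [NormedAddCommGroup EN] [NormedSpace ℝ EN] [TopologicalSpace HN]
  [TopologicalSpace N] [ChartedSpace HN N]

/-- A map defined on a subset `S` of a manifold is smooth if near each point of `S` it extends to a
smooth map on an open set of the manifold.  For an embedded submanifold `S`, as the jet bundle is,
this is smoothness for the submanifold structure. -/
def IsSmoothOnSubset (I : ModelWithCorners ℝ EX HX) (J : ModelWithCorners ℝ EN HN) {S : Set X}
    (f : S → N) : Prop :=
  ∀ u : S, ∃ (U : Set X) (F : X → N), IsOpen U ∧ u.1 ∈ U ∧ ContMDiffOn I J ∞ F U ∧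
    ∀ v : S, v.1 ∈ U → f v = F v.1

end Smooth

section Concomitants

variable {EM HM M E₁ H₁ B₁ E₂ H₂ B₂ : Type*}
  [NormedAddCommGroup EM] [NormedSpace ℝ EM] [TopologicalSpace HM]
  {I : ModelWithCorners ℝ EM HM} [TopologicalSpace M] [ChartedSpace HM M]
  [NormedAddCommGroup E₁] [NormedSpace ℝ E₁] [TopologicalSpace H₁]
  {J₁ : ModelWithCorners ℝ E₁ H₁} [TopologicalSpace B₁] [ChartedSpace H₁ B₁]
  [NormedAddCommGroup E₂] [NormedSpace ℝ E₂] [TopologicalSpace H₂]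
  {J₂ : ModelWithCorners ℝ E₂ H₂} [TopologicalSpace B₂] [ChartedSpace H₂ B₂]
  {pr₁ : C^∞⟮J₁, B₁; I, M⟯} {pr₂ : C^∞⟮J₂, B₂; I, M⟯}

/-- `χ` is a (zeroth-order) concomitant from the bundle `B₁` to the bundle `B₂`: a smooth map that
intertwines the inductions. -/
def IsConcomitant (ι₁ : Induction pr₁) (ι₂ : Induction pr₂) (χ : B₁ → B₂) : Prop :=
  ContMDiff J₁ J₂ ∞ χ ∧ ∀ φ u, χ (ι₁ φ u) = ι₂ φ (χ u)

variable [IsManifold I ∞ M] [IsManifold J₁ ∞ B₁]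

/-- `χ : J¹B₁ → B₂` is smooth and intertwines the first prolongation of the induction of `B₁` with
the induction of `B₂`. -/
def IsNaturalJetMap (ι₁ : Induction pr₁) (ι₂ : Induction pr₂) (χ : Jet1 pr₁ → B₂) : Prop :=
  IsSmoothOnSubset (J₁.prod 𝓘(ℝ, EM →L[ℝ] E₁)) J₂ χ ∧
    ∀ φ u, χ (ι₁.prolong φ u) = ι₂ φ (χ u)

/-- `χ : J¹B₁ → B₂` is a first-order concomitant from `B₁` to `B₂`: it is smooth and natural, and it
does not factor through the projection `J¹B₁ → B₁` and a concomitant from `B₁` to `B₂`. -/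
def IsFirstOrderConcomitant (ι₁ : Induction pr₁) (ι₂ : Induction pr₂) (χ : Jet1 pr₁ → B₂) :
    Prop :=
  IsNaturalJetMap ι₁ ι₂ χ ∧
    ¬ ∃ χ' : B₁ → B₂, IsConcomitant ι₁ ι₂ χ' ∧ ∀ u, χ u = χ' u.truncate

end Concomitants

section Tensors


variable (E : Type*) [NormedAddCommGroup E] [NormedSpace ℝ E]

/-- The kinds of tensor indices. -/
inductive Index
  | up
  | down

/-- The kind of argument that a tensor takes at an index: a covector at an upper index, a vector at a
lower index. -/
def Slot : Index → Type _
  | .up => E →L[ℝ] ℝ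
  | .down => E

instance : ∀ i, NormedAddCommGroup (Slot E i)
  | .up => inferInstanceAs (NormedAddCommGroup (E →L[ℝ] ℝ))
  | .down => inferInstanceAs (NormedAddCommGroup E)

instance : ∀ i, NormedSpace ℝ (Slot E i)
  | .up => inferInstanceAs (NormedSpace ℝ (E →L[ℝ] ℝ))
  | .down => inferInstanceAs (NormedSpace ℝ E)

/-- The tensors over `E` with index structure `σ`: real-valued multilinear maps with one covector
argument for each upper index and one vector argument for each lower index. -/
abbrev Tensors {k : ℕ} (σ : Fin k → Index) : Type _ :=
  ContinuousMultilinearMap ℝ (fun i => Slot E (σ i)) ℝ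

variable {E} in
/-- The transformation of the arguments of a tensor by `A` with inverse `B`: covectors are composed
with `A`, vectors are mapped by `B`. -/
def slotMap (A B : E →L[ℝ] E) : ∀ i, Slot E i →L[ℝ] Slot E i
  | .up => (ContinuousLinearMap.compL ℝ E E ℝ).flip A
  | .down => B

set_option synthInstance.maxHeartbeats 400000 in
/-- The natural action on tensors: `A` sends `t` to `t (.. α ∘ A .., .. A⁻¹ v ..)`. -/
def tensorAction {k : ℕ} (σ : Fin k → Index) : TensorialAction E (Tensors E σ) where
  act A B := ContinuousMultilinearMap.compContinuousLinearMapL fun i => slotMap A B (σ i)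
  contDiff_act := by
    have h : ∀ i, ContDiff ℝ ∞
        (fun p : (E →L[ℝ] E) × (E →L[ℝ] E) => slotMap p.1 p.2 i) := by
      rintro (_ | _)
      · have h₁ : ContDiff ℝ ∞ (fun A : E →L[ℝ] E => (ContinuousLinearMap.compL ℝ E E ℝ).flip A) :=
          ContinuousLinearMap.contDiff _
        exact h₁.comp contDiff_fst
      · exact contDiff_snd
    have h' : ContDiff ℝ ∞ (fun p : (E →L[ℝ] E) × (E →L[ℝ] E) => fun i : Fin k =>
        slotMap p.1 p.2 (σ i)) := contDiff_pi.2 fun i => h (σ i)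
    exact (ContinuousMultilinearMap.contDiff (𝕜 := ℝ) (ι := Fin k)
      (E := fun i => Slot E (σ i) →L[ℝ] Slot E (σ i)) (F := Tensors E σ →L[ℝ] Tensors E σ)
      (ContinuousMultilinearMap.compContinuousLinearMapContinuousMultilinear ℝ
        (fun i => Slot E (σ i)) (fun i => Slot E (σ i)) ℝ)).comp h'
  act_id := by
    have h : ∀ i (v : Slot E i), slotMap (.id ℝ E) (.id ℝ E) i v = v := by
      rintro (_ | _) v <;> rfl
    ext t v
    exact congrArg t (funext fun i => h _ _)
  act_comp A₁ A₂ B₁ B₂ := by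
    have h : ∀ i (v : Slot E i), slotMap (A₂ ∘L A₁) (B₁ ∘L B₂) i v =
        slotMap A₁ B₁ i (slotMap A₂ B₂ i v) := by
      rintro (_ | _) v <;> rfl
    ext t v
    exact congrArg t (funext fun i => h _ _)


end Tensors

section Metrics

variable (E : Type*) [NormedAddCommGroup E] [NormedSpace ℝ E]

/-- The symmetric covariant 2-tensors on `E`. -/
def symSubmodule : Submodule ℝ (ContinuousMultilinearMap ℝ (fun _ : Fin 2 => E) ℝ) where
  carrier := {g | ∀ v w, g ![v, w] = g ![w, v]}
  add_mem' hg hh v w := by simp [hg v w, hh v w]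
  zero_mem' v w := rfl
  smul_mem' c g hg v w := by simp [hg v w]

/-- The normed space of symmetric covariant 2-tensors on `E`. -/
def SymForm : Type _ := symSubmodule E

instance : NormedAddCommGroup (SymForm E) := inferInstanceAs (NormedAddCommGroup (symSubmodule E))

instance : NormedSpace ℝ (SymForm E) := inferInstanceAs (NormedSpace ℝ (symSubmodule E))

namespace SymForm

variable {E}

variable (E) in
/-- The inclusion into the space of all covariant 2-tensors. -/
def incl : SymForm E →L[ℝ] ContinuousMultilinearMap ℝ (fun _ : Fin 2 => E) ℝ :=
  (symSubmodule E).subtypeL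

/-- Corestriction of a linear map with symmetric values. -/
def lift {V : Type*} [NormedAddCommGroup V] [NormedSpace ℝ V]
    (f : V →L[ℝ] ContinuousMultilinearMap ℝ (fun _ : Fin 2 => E) ℝ)
    (h : ∀ x v w, f x ![v, w] = f x ![w, v]) : V →L[ℝ] SymForm E :=
  f.codRestrict (symSubmodule E) h

/-- Pullback `(v, w) ↦ g (B v, B w)` of a symmetric form. -/
def pull (B : E →L[ℝ] E) : SymForm E →L[ℝ] SymForm E :=
  lift ((ContinuousMultilinearMap.compContinuousLinearMapL (fun _ : Fin 2 => B)).comp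
    (incl E)) (fun g v w => by
      have h : ∀ v w : E, (fun i => B (![v, w] i)) = ![B v, B w] := by
        intro v w; ext i; fin_cases i <;> rfl
      have h' := g.2 (B v) (B w)
      rw [← h, ← h] at h'
      exact h')

theorem pull_apply (B : E →L[ℝ] E) (g : SymForm E) (v w : E) :
    (pull B g).1 ![v, w] = g.1 ![B v, B w] := by
  have h : (fun i => B (![v, w] i)) = ![B v, B w] := by ext i; fin_cases i <;> rfl
  exact congrArg g.1 h

theorem ext_pair {g h : SymForm E} (H : ∀ v w, g.1 ![v, w] = h.1 ![v, w]) : g = h := by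
  refine Subtype.ext (ContinuousMultilinearMap.ext fun m => ?_)
  have hm : m = ![m 0, m 1] := by ext i; fin_cases i <;> rfl
  rw [hm]; exact H _ _

variable (E) in
/-- Symmetrization of covariant 2-tensors. -/
def symmetrize : (ContinuousMultilinearMap ℝ (fun _ : Fin 2 => E) ℝ) →L[ℝ] SymForm E :=
  lift ((2⁻¹ : ℝ) • (ContinuousLinearMap.id ℝ _ +
    ((ContinuousMultilinearMap.domDomCongrₗᵢ ℝ E ℝ
      (Equiv.swap (0 : Fin 2) 1)).toContinuousLinearEquiv.toContinuousLinearMap)))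
    (fun g v w => by
      have h : ∀ v w : E, (fun i => ![v, w] (Equiv.swap (0 : Fin 2) 1 i)) = ![w, v] := by
        intro v w; ext i; fin_cases i <;> simp
      change (2⁻¹ : ℝ) * (g ![v, w] + g (fun i => ![v, w] (Equiv.swap (0 : Fin 2) 1 i))) =
        (2⁻¹ : ℝ) * (g ![w, v] + g (fun i => ![w, v] (Equiv.swap (0 : Fin 2) 1 i)))
      rw [h, h, add_comm])

theorem symmetrize_coe (g : SymForm E) : symmetrize E g.1 = g := by
  refine ext_pair fun v w => ?_
  have h : ∀ v w : E, (fun i => ![v, w] (Equiv.swap (0 : Fin 2) 1 i)) = ![w, v] := by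
    intro v w; ext i; fin_cases i <;> simp
  change (2⁻¹ : ℝ) * (g.1 ![v, w] + g.1 (fun i => ![v, w] (Equiv.swap (0 : Fin 2) 1 i))) = _
  rw [h, g.2 w v]; ring

theorem contDiff_pull : ContDiff ℝ ∞ (pull : (E →L[ℝ] E) → SymForm E →L[ℝ] SymForm E) := by
  have h : (pull : (E →L[ℝ] E) → SymForm E →L[ℝ] SymForm E) = fun B =>
      (symmetrize E).comp ((ContinuousMultilinearMap.compContinuousLinearMapContinuousMultilinear
        ℝ (fun _ : Fin 2 => E) (fun _ : Fin 2 => E) ℝ (fun _ => B)).comp (incl E)) := by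
    ext1 B; ext1 g; exact (symmetrize_coe _).symm
  rw [h]
  have h₂ : ContDiff ℝ ∞ (fun B : E →L[ℝ] E => fun _ : Fin 2 => B) :=
    contDiff_pi.2 fun _ => contDiff_id
  have h₃ := (ContinuousMultilinearMap.contDiff (𝕜 := ℝ) (n := ∞) (ι := Fin 2)
    (E := fun _ => E →L[ℝ] E)
    (F := ContinuousMultilinearMap ℝ (fun _ : Fin 2 => E) ℝ →L[ℝ]
      ContinuousMultilinearMap ℝ (fun _ : Fin 2 => E) ℝ)
    (ContinuousMultilinearMap.compContinuousLinearMapContinuousMultilinear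
        ℝ (fun _ : Fin 2 => E) (fun _ : Fin 2 => E) ℝ)).comp h₂
  exact contDiff_const.clm_comp (h₃.clm_comp contDiff_const)

variable (E) in
/-- Covariant tensors transform by the inverse of the frame change. -/
def action : TensorialAction E (SymForm E) where
  act _ B := pull B
  contDiff_act := contDiff_pull.comp contDiff_snd
  act_id := by ext1 g; rfl
  act_comp A₁ A₂ B₁ B₂ := by ext1 g; rfl

/-- The quadratic form `v ↦ g (v, v)`. -/
def quad (g : SymForm E) : QuadraticForm ℝ E :=
  LinearMap.BilinMap.toQuadraticMap (LinearMap.mk₂ ℝ (fun v w => g.1 ![v, w])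
    (fun v v' w => g.1.cons_add ![w] v v')
    (fun c v w => g.1.cons_smul ![w] c v)
    (fun v w w' => by rw [g.2, g.2 v w, g.2 v w']; exact g.1.cons_add ![v] w w')
    (fun c v w => by rw [g.2, g.2 v w]; exact g.1.cons_smul ![v] c w))

theorem quad_apply (g : SymForm E) (v : E) : g.quad v = g.1 ![v, v] := rfl

/-- `g` is a Lorentz metric: its signature is `(+, -, -, -)`. -/
def IsLorentz (g : SymForm E) : Prop := sigPos g.quad = 1 ∧ sigNeg g.quad = 3

theorem IsLorentz.pull {g : SymForm E} (hg : g.IsLorentz) {B B' : E →L[ℝ] E}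
    (h₁ : B ∘L B' = .id ℝ E) (h₂ : B' ∘L B = .id ℝ E) : (pull B g).IsLorentz := by
  have e : QuadraticMap.Equivalent (SymForm.pull B g).quad g.quad :=
    ⟨{ (LinearEquiv.ofLinearMap (B : E →ₗ[ℝ] E) (B' : E →ₗ[ℝ] E)
        (by ext v; exact DFunLike.congr_fun h₁ v) (by ext v; exact DFunLike.congr_fun h₂ v) : E ≃ₗ[ℝ] E) with
        map_app' := fun v => (pull_apply B g v v).symm }⟩
  exact ⟨e.sigPos_eq.trans hg.1, e.sigNeg_eq.trans hg.2⟩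

theorem isLorentz_pull_iff {g : SymForm E} {B B' : E →L[ℝ] E}
    (h₁ : B ∘L B' = .id ℝ E) (h₂ : B' ∘L B = .id ℝ E) : (pull B g).IsLorentz ↔ g.IsLorentz := by
  refine ⟨fun h => ?_, fun h => h.pull h₁ h₂⟩
  have e : pull B' (pull B g) = g := ext_pair fun v w => by
    rw [pull_apply, pull_apply]
    have h₃ : ∀ v, B (B' v) = v := fun v => DFunLike.congr_fun h₁ v
    rw [h₃, h₃]
  rw [← e]
  exact h.pull h₂ h₁

theorem isLorentz_iff [FiniteDimensional ℝ E] (hE : Module.finrank ℝ E = 4) (g : SymForm E) :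
    g.IsLorentz ↔ ∃ P N : Submodule ℝ E, Module.finrank ℝ P = 1 ∧ Module.finrank ℝ N = 3 ∧
      (∀ v ∈ P, v ≠ 0 → 0 < g.1 ![v, v]) ∧ ∀ v ∈ N, v ≠ 0 → 0 < -g.1 ![v, v] := by
  have pd : ∀ (Q : QuadraticForm ℝ E) (V : Submodule ℝ E),
      (Q.restrict V).PosDef ↔ ∀ v ∈ V, v ≠ 0 → 0 < Q v := by
    intro Q V
    constructor
    · intro h v hv h0
      exact h ⟨v, hv⟩ (by simpa using h0)
    · rintro h ⟨v, hv⟩ h0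
      exact h v hv (by simpa using h0)
  constructor
  · rintro ⟨h₁, h₂⟩
    obtain ⟨P, hP, hP'⟩ := exists_finrank_eq_sigPos_and_posDef g.quad
    obtain ⟨N, hN, hN'⟩ := exists_finrank_eq_sigNeg_and_negDef g.quad
    exact ⟨P, N, hP.trans h₁, hN.trans h₂, (pd _ _).1 hP', (pd _ _).1 hN'⟩
  · rintro ⟨P, N, hP, hN, hP', hN'⟩
    have a₁ := le_sigPos_of_posDef (Q := g.quad) ((pd _ _).2 hP')
    have a₂ := le_sigNeg_of_negDef (Q := g.quad) ((pd (-g.quad) _).2 hN')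
    have b₁ := QuadraticForm.sigPos_add_finrank_le_of_nonpos (Q := g.quad) (V := N)
      (fun v hv => by
        by_cases h0 : v = 0
        · simp [h0]
        · have := hN' v hv h0; rw [quad_apply]; linarith)
    have b₂ := QuadraticForm.sigPos_add_finrank_le_of_nonpos (Q := -g.quad) (V := P)
      (fun v hv => by
        by_cases h0 : v = 0
        · simp [h0]
        · have := hP' v hv h0; change -g.1 ![v, v] ≤ 0; linarith)
    rw [sigPos_neg] at b₂
    exact ⟨by omega, by omega⟩

theorem isOpen_isLorentz [FiniteDimensional ℝ E] (hE : Module.finrank ℝ E = 4) :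
    IsOpen {g : SymForm E | g.IsLorentz} := by
  have hcont : Continuous (fun p : SymForm E × E => p.1.1 ![p.2, p.2]) := by
    have : (fun p : SymForm E × E => p.1.1 ![p.2, p.2]) =
        fun p : SymForm E × E => p.1.1 (fun _ => p.2) := by
      ext p; congr 1; ext i; fin_cases i <;> rfl
    rw [this]
    fun_prop
  have key : ∀ (c : ℝ) (V : Submodule ℝ E),
      IsOpen {g : SymForm E | ∀ v ∈ V, v ≠ 0 → 0 < c * g.1 ![v, v]} := by
    intro c V
    have hK : IsCompact ((V : Set E) ∩ Metric.sphere 0 1) :=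
      (isCompact_sphere (0 : E) 1).inter_left V.closed_of_finiteDimensional
    have hset : {g : SymForm E | ∀ v ∈ V, v ≠ 0 → 0 < c * g.1 ![v, v]} =
        {g : SymForm E | ∀ v ∈ (V : Set E) ∩ Metric.sphere 0 1, 0 < c * g.1 ![v, v]} := by
      ext g
      constructor
      · rintro h v ⟨hv, hs⟩
        refine h v hv ?_
        rintro rfl
        simp at hs
      · intro h v hv h0
        have hn : ‖v‖ ≠ 0 := norm_ne_zero_iff.2 h0
        have h1 := h (‖v‖⁻¹ • v) ⟨V.smul_mem _ hv, by simp [norm_smul, hn]⟩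
        have h2 : g.quad (‖v‖⁻¹ • v) = ‖v‖⁻¹ * ‖v‖⁻¹ * g.quad v := by
          rw [QuadraticMap.map_smul, smul_eq_mul]
        rw [quad_apply, quad_apply] at h2
        rw [h2] at h1
        have h3 : 0 < ‖v‖⁻¹ * ‖v‖⁻¹ := by positivity
        have h4 : 0 < (‖v‖⁻¹ * ‖v‖⁻¹) * (c * g.1 ![v, v]) := by
          convert h1 using 1; ring
        exact pos_of_mul_pos_right h4 h3.le
    rw [hset, isOpen_iff_mem_nhds]
    intro g hg
    refine hK.eventually_forall_of_forall_eventually fun v hv => ?_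
    have hc : Continuous (fun p : SymForm E × E => c * p.1.1 ![p.2, p.2]) :=
      continuous_const.mul hcont
    exact hc.continuousAt.eventually (lt_mem_nhds (hg v hv))
  have hU : {g : SymForm E | g.IsLorentz} = ⋃ (P : Submodule ℝ E) (N : Submodule ℝ E)
      (_ : Module.finrank ℝ P = 1) (_ : Module.finrank ℝ N = 3),
      {g : SymForm E | ∀ v ∈ P, v ≠ 0 → 0 < 1 * g.1 ![v, v]} ∩
        {g : SymForm E | ∀ v ∈ N, v ≠ 0 → 0 < (-1) * g.1 ![v, v]} := by
    ext g
    simp only [Set.mem_ofPred_eq, isLorentz_iff hE, Set.mem_iUnion, Set.mem_inter_iff, one_mul,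
      neg_one_mul, exists_prop]
  rw [hU]
  exact isOpen_iUnion fun P => isOpen_iUnion fun N => isOpen_iUnion fun _ => isOpen_iUnion fun _ =>
    (key 1 P).inter (key (-1) N)

/-- The Minkowski metric on `ℝ⁴`. -/
def minkowski : SymForm (EuclideanSpace ℝ (Fin 4)) :=
  symmetrize _ (∑ i : Fin 4, (if i = 0 then 1 else -1 : ℝ) •
    (ContinuousMultilinearMap.mkPiAlgebra ℝ (Fin 2) ℝ).compContinuousLinearMap
      (fun _ => EuclideanSpace.proj i))

theorem minkowski_apply (v : EuclideanSpace ℝ (Fin 4)) :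
    minkowski.quad v = ∑ i : Fin 4, (if i = 0 then 1 else -1 : ℝ) * (v i * v i) := by
  have h : ∀ w : EuclideanSpace ℝ (Fin 4), (fun i => ![w, w] (Equiv.swap (0 : Fin 2) 1 i)) =
      ![w, w] := by
    intro w; ext i; fin_cases i <;> simp
  have h' : ∀ g : ContinuousMultilinearMap ℝ (fun _ : Fin 2 => EuclideanSpace ℝ (Fin 4)) ℝ,
      (symmetrize _ g).quad v = g ![v, v] := by
    intro g
    change (2⁻¹ : ℝ) * (g ![v, v] + g (fun i => ![v, v] (Equiv.swap (0 : Fin 2) 1 i))) = _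
    rw [h]; ring
  rw [minkowski, h', sum_apply]
  refine Finset.sum_congr rfl fun i _ => ?_
  change _ * (∏ j : Fin 2, (![v, v] j) i) = _
  rw [Fin.prod_univ_two]; rfl

theorem isLorentz_minkowski : minkowski.IsLorentz := by
  have e : QuadraticMap.Equivalent minkowski.quad
      (QuadraticMap.weightedSumSquares ℝ (fun i : Fin 4 => (if i = 0 then 1 else -1 : ℝ))) :=
    ⟨{ (EuclideanSpace.equiv (Fin 4) ℝ).toLinearEquiv with
        map_app' := fun v => by
          rw [minkowski_apply, QuadraticMap.weightedSumSquares_apply]; rfl }⟩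
  have h₁ : {i : Fin 4 | 0 < (if i = 0 then 1 else -1 : ℝ)} = {0} := by
    ext i; by_cases hi : i = 0 <;> simp [hi]
  have h₂ : {i : Fin 4 | (if i = 0 then 1 else -1 : ℝ) < 0} = {1, 2, 3} := by
    ext i; fin_cases i <;> simp
  refine ⟨?_, ?_⟩
  · rw [QuadraticForm.sigPos_of_equiv_weightedSumSquares e, h₁, Set.ncard_singleton]
  · rw [QuadraticForm.sigNeg_of_equiv_weightedSumSquares e, h₂]
    rw [Set.ncard_eq_toFinset_card']; rfl

end SymForm

end Metrics

section Bundles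

namespace TensorialAction

variable {E W H : Type*} [NormedAddCommGroup E] [NormedSpace ℝ E]
  [NormedAddCommGroup W] [NormedSpace ℝ W] [TopologicalSpace H] {I : ModelWithCorners ℝ E H}
  {M : Type*} [TopologicalSpace M] [ChartedSpace H M] [IsManifold I ∞ M] (ρ : TensorialAction E W)

variable (I M) in
/-- The bundle projection. -/
def projection : C^∞⟮I.prod 𝓘(ℝ, W), ρ.Total I M; I, M⟯ :=
  ⟨fun u => u.1, Bundle.contMDiff_proj _⟩

theorem push_eq_self (φ : M ≃ₘ^∞⟮I, I⟯ M) {O : Set M} (hO : IsOpen O) (h : ∀ x ∈ O, φ x = x)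
    (u : ρ.Total I M) (hu : u.1 ∈ O) : ρ.push φ u = u := by
  obtain ⟨x, w⟩ := u
  have hx : φ x = x := h x hu
  have h₁ : mfderiv I I φ x = (.id ℝ E : E →L[ℝ] E) := by
    have e : (φ : M → M) =ᶠ[𝓝 x] id := Filter.eventually_of_mem (hO.mem_nhds hu) h
    exact e.mfderiv_eq.trans mfderiv_id
  have h₂ : mfderiv I I φ.symm x = (.id ℝ E : E →L[ℝ] E) := by
    have e : (φ.symm : M → M) =ᶠ[𝓝 x] id := Filter.eventually_of_mem (hO.mem_nhds hu)
      fun y hy => by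
        have := φ.symm_apply_apply y
        rwa [h y hy] at this
    exact e.mfderiv_eq.trans mfderiv_id
  have h₃ : (mfderiv I I φ.symm (φ x) : E →L[ℝ] E) = .id ℝ E := by
    have hc : ∀ y, y = x → (mfderiv I I φ.symm y : E →L[ℝ] E) = .id ℝ E := by
      rintro y rfl; exact h₂
    exact hc _ hx
  have h₄ : ρ.act (mfderiv I I φ x) (mfderiv I I φ.symm (φ x)) w = w := by
    have hc : ∀ A B : E →L[ℝ] E, A = .id ℝ E → B = .id ℝ E → ρ.act A B w = w := by
      rintro _ _ rfl rfl; exact DFunLike.congr_fun ρ.act_id w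
    exact hc _ _ h₁ h₃
  exact congrArg₂ (fun (y : M) (v : W) => (⟨y, v⟩ : ρ.Total I M)) hx h₄

/-- The natural induction of a bundle of tensors. -/
def induction : Induction (ρ.projection I M) where
  toFun := ρ.induced
  consistent _ _ := rfl
  strongly_consistent φ _ hO h u hu := ρ.push_eq_self φ hO h u hu
  map_refl := Diffeomorph.ext ρ.push_refl
  map_trans φ ψ := Diffeomorph.ext (ρ.push_trans φ ψ)
  injective _ _ h := Diffeomorph.ext fun x =>
    congrArg (fun f => (f (⟨x, (0 : W)⟩ : ρ.Total I M)).1) h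

end TensorialAction

end Bundles

section Spacetime

variable (M : Type*) [TopologicalSpace M] [ChartedSpace (EuclideanSpace ℝ (Fin 4)) M]
  [IsManifold (𝓡 4) ∞ M]

/-- The total space of the bundle of symmetric covariant 2-tensors. -/
abbrev SymBundle : Type _ := (SymForm.action (EuclideanSpace ℝ (Fin 4))).Total (𝓡 4) M

/-- The bundle of Lorentz metrics: the open submanifold of the bundle of symmetric covariant 2-tensors
on `M` that consists of the forms of signature `(+, -, -, -)` on the tangent spaces of `M`. -/
def MetricBundle : TopologicalSpace.Opens (SymBundle M) where
  carrier := {u | SymForm.IsLorentz (E := EuclideanSpace ℝ (Fin 4)) u.2}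
  is_open' := by
    set T := tangentBundleCore (𝓡 4) M with hT
    refine isOpen_iff_forall_mem_open.2 fun u₀ hu₀ => ?_
    set e := trivializationAt (SymForm (EuclideanSpace ℝ (Fin 4)))
      ((SymForm.action (EuclideanSpace ℝ (Fin 4))).core (𝓡 4) M).Fiber u₀.1 with he
    have key : ∀ u ∈ e.source, ((e u).2.IsLorentz ↔
        SymForm.IsLorentz (E := EuclideanSpace ℝ (Fin 4)) u.2) := by
      intro u hu
      have h₀ : u.1 ∈ T.baseSet (achart _ u₀.1) := e.mem_source.1 hu
      have h₁ : u.1 ∈ T.baseSet (achart _ u.1) := mem_chart_source _ u.1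
      refine SymForm.isLorentz_pull_iff (B := T.coordChange (achart _ u₀.1) (achart _ u.1) u.1)
        (B' := T.coordChange (achart _ u.1) (achart _ u₀.1) u.1) ?_ ?_
      · ext1 v
        exact (T.coordChange_comp _ _ _ u.1 ⟨⟨h₁, h₀⟩, h₁⟩ v).trans (T.coordChange_self _ _ h₁ v)
      · ext1 v
        exact (T.coordChange_comp _ _ _ u.1 ⟨⟨h₀, h₁⟩, h₀⟩ v).trans (T.coordChange_self _ _ h₀ v)
    have ho : IsOpen (e.source ∩ e ⁻¹' (Set.univ ×ˢ
        {g : SymForm (EuclideanSpace ℝ (Fin 4)) | g.IsLorentz})) :=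
      e.continuousOn.isOpen_inter_preimage e.open_source
        (isOpen_univ.prod (SymForm.isOpen_isLorentz (by simp)))
    have hs : u₀ ∈ e.source := e.mem_source.2 (FiberBundle.mem_baseSet_trivializationAt' u₀.1)
    exact ⟨_, fun u hu => (key u hu.1).1 hu.2.2, ho, hs, Set.mem_univ _, (key u₀ hs).2 hu₀⟩

/-- The model with corners of the bundle of Lorentz metrics. -/
abbrev metricModel := (𝓡 4).prod 𝓘(ℝ, SymForm (EuclideanSpace ℝ (Fin 4)))

/-- The projection of the bundle of Lorentz metrics to `M`. -/
def metricProjection : C^∞⟮metricModel, MetricBundle M; 𝓡 4, M⟯ :=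
  ((SymForm.action (EuclideanSpace ℝ (Fin 4))).projection (𝓡 4) M).comp
    ⟨Subtype.val, contMDiff_subtype_val⟩

variable {M}

theorem push_mem_metricBundle (φ : M ≃ₘ^∞⟮𝓡 4, 𝓡 4⟯ M) (u : MetricBundle M) :
    (SymForm.action (EuclideanSpace ℝ (Fin 4))).push φ u.1 ∈ MetricBundle M := by
  have h₁ := mfderiv_symm_comp φ u.1.1
  have h₂ := mfderiv_symm_comp φ.symm (φ u.1.1)
  have hc : ∀ y, y = u.1.1 → mfderiv (𝓡 4) (𝓡 4) φ y ∘L mfderiv (𝓡 4) (𝓡 4) φ.symm (φ u.1.1) =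
      (.id ℝ _ : EuclideanSpace ℝ (Fin 4) →L[ℝ] EuclideanSpace ℝ (Fin 4)) →
      mfderiv (𝓡 4) (𝓡 4) φ u.1.1 ∘L mfderiv (𝓡 4) (𝓡 4) φ.symm (φ u.1.1) =
      (.id ℝ _ : EuclideanSpace ℝ (Fin 4) →L[ℝ] EuclideanSpace ℝ (Fin 4)) := by
    rintro y rfl h; exact h
  exact SymForm.IsLorentz.pull (E := EuclideanSpace ℝ (Fin 4)) u.2 h₁
    (hc _ (φ.symm_apply_apply _) h₂)

/-- The natural transport of Lorentz metrics by a diffeomorphism of `M`. -/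
def metricInduced (φ : M ≃ₘ^∞⟮𝓡 4, 𝓡 4⟯ M) :
    MetricBundle M ≃ₘ^∞⟮metricModel, metricModel⟯ MetricBundle M where
  toFun u := ⟨_, push_mem_metricBundle φ u⟩
  invFun u := ⟨_, push_mem_metricBundle φ.symm u⟩
  left_inv u := Subtype.ext ((TensorialAction.induced _ φ).left_inv u.1)
  right_inv u := Subtype.ext ((TensorialAction.induced _ φ).right_inv u.1)
  contMDiff_toFun := (ContMDiff.subtypeVal_comp_iff _ _).1
    ((TensorialAction.contMDiff_push _ φ).comp contMDiff_subtype_val)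
  contMDiff_invFun := (ContMDiff.subtypeVal_comp_iff _ _).1
    ((TensorialAction.contMDiff_push _ φ.symm).comp contMDiff_subtype_val)

variable (M) in
/-- The natural induction of the bundle of Lorentz metrics. -/
def metricInduction : Induction (metricProjection M) where
  toFun := metricInduced
  consistent _ _ := rfl
  strongly_consistent φ _ hO h u hu :=
    Subtype.ext (TensorialAction.push_eq_self _ φ hO h u.1 hu)
  map_refl := Diffeomorph.ext fun u => Subtype.ext (TensorialAction.push_refl _ u.1)
  map_trans φ ψ := Diffeomorph.ext fun u => Subtype.ext (TensorialAction.push_trans _ φ ψ u.1)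
  injective _ _ h := Diffeomorph.ext fun x =>
    congrArg (fun f => (f (⟨⟨x, SymForm.minkowski⟩, SymForm.isLorentz_minkowski⟩ :
      MetricBundle M)).1.1) h

variable (M) in
/-- The bundle of tensors over `M` with index structure `σ`. -/
abbrev TensorBundle {k : ℕ} (σ : Fin k → Index) : Type _ :=
  (tensorAction (EuclideanSpace ℝ (Fin 4)) σ).Total (𝓡 4) M

variable (M) in
/-- The natural induction of a bundle of tensors over `M`. -/
def tensorInduction {k : ℕ} (σ : Fin k → Index) :
    Induction ((tensorAction (EuclideanSpace ℝ (Fin 4)) σ).projection (𝓡 4) M) :=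
  (tensorAction (EuclideanSpace ℝ (Fin 4)) σ).induction

end Spacetime

end Concomitant

end

/-! The first derivatives of a Lorentz metric at a point carry no invariant information: a change of
coordinates with identity tangent map at the point gives them any prescribed value. Let two jets at
`p` have the same value `g`, and let `D` be the difference of their first derivatives in a chart.
The algebra of the Levi-Civita connection (`SymForm.IsLorentz.exists_christoffel`) yields a
symmetric bilinear `Q` with `D v (a, b) = g (Q v a, b) + g (a, Q v b)`. By `fderiv_pull_quadMap`,
pullback along `x + Q (x - x₀, x - x₀) / 2` adds exactly `D` to the first derivatives and leaves the
value alone. Cut off and extended by the identity (`exists_diffeomorph_quadratic`), this map becomes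
a global diffeomorphism, whose inverse carries one jet to the other
(`exists_diffeomorph_prolong_eq`).

Tensors see only the tangent map, so this diffeomorphism fixes every tensor at `p`. Naturality then
forces `χ` to agree on the two jets. Nothing says in advance that `χ` covers the identity of `M`:
its value may lie over some `q ≠ p`. In that case the support of the diffeomorphism is shrunk away
from `q`, and the value is fixed again.

Hence `χ` factors through the value of the metric. The factor is smooth because `J¹B → B` has smooth
local sections, namely the jets of metrics with constant coefficients in a fixed chart
(`contMDiffAt_parallelJet`). The absence of first-order concomitants is the same factorization. -/

namespace Concomitant

/-! ### Compactly supported perturbations of the identity, in the model space and on the manifold -/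

/-- A smooth strictly contracting perturbation of the identity is a diffeomorphism. -/
theorem exists_homeomorph_id_add {E : Type*} [NormedAddCommGroup E] [NormedSpace ℝ E]
    [CompleteSpace E] {g : E → E} (hg : ContDiff ℝ ∞ g) {K : NNReal} (hK : K < 1)
    (hL : LipschitzWith K g) :
    ∃ Φ : E ≃ₜ E, (∀ x, Φ x = x + g x) ∧ ContDiff ℝ ∞ Φ ∧ ContDiff ℝ ∞ Φ.symm := by
  have ha : ApproximatesLinearOn (fun x => x + g x)
      ((ContinuousLinearEquiv.refl ℝ E : E ≃L[ℝ] E) : E →L[ℝ] E) Set.univ K := by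
    intro x _ y _
    have : x + g x - (y + g y) - (x - y) = g x - g y := by abel
    simpa [this] using hL.norm_sub_le x y
  -- The identity has operator norm 1 only on a nontrivial space, hence the case distinction.
  have hc : Subsingleton E ∨ K < ‖((ContinuousLinearEquiv.refl ℝ E : E ≃L[ℝ] E).symm :
      E →L[ℝ] E)‖₊⁻¹ := by
    by_cases h : Subsingleton E
    · exact .inl h
    · have : Nontrivial E := not_subsingleton_iff_nontrivial.1 h
      refine .inr ?_
      have h₁ : ‖((ContinuousLinearEquiv.refl ℝ E : E ≃L[ℝ] E).symm : E →L[ℝ] E)‖₊ = 1 :=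
        NNReal.eq ContinuousLinearMap.norm_id
      rw [h₁]
      simpa using hK
  let Φ := ha.toHomeomorph _ hc
  have hΦ : ∀ x, Φ x = x + g x := fun _ => rfl
  have hs : ContDiff ℝ ∞ Φ := contDiff_id.add hg
  -- The derivative of `g` has norm at most `K < 1`, so the Neumann series inverts that of `Φ`; this
  -- makes the inverse homeomorphism smooth.
  have hu : ∀ x, IsUnit (1 - -fderiv ℝ g x) := fun x => by
    refine isUnit_one_sub_of_norm_lt_one ?_
    rw [norm_neg]
    exact (norm_fderiv_le_of_lipschitz ℝ hL).trans_lt hK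
  refine ⟨Φ, hΦ, hs, Φ.contDiff_symm
    (f₀' := fun x => ContinuousLinearEquiv.unitsEquiv ℝ E (hu x).unit) (fun x => ?_) hs⟩
  have h := (hasFDerivAt_id (𝕜 := ℝ) x).add ((hg.differentiable (by simp)) x).hasFDerivAt
  refine h.congr_fderiv ?_
  ext v
  change v + fderiv ℝ g x v = (1 - -fderiv ℝ g x) v
  simp

/-- Conjugation by the chart `e` of a map of the model space, extended by the identity. -/
noncomputable def chartConj {E M : Type*} [TopologicalSpace E] [TopologicalSpace M] (e : OpenPartialHomeomorph M E)
    (f : E → E) (q : M) : M :=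
  open scoped Classical in if q ∈ e.source then e.symm (f (e q)) else q

section Transport

variable {E : Type*} [NormedAddCommGroup E] {M : Type*} [TopologicalSpace M]

theorem chartConj_of_mem {e : OpenPartialHomeomorph M E} {f : E → E} {q : M}
    (hq : q ∈ e.source) : chartConj e f q = e.symm (f (e q)) := if_pos hq

theorem chartConj_eq_self {e : OpenPartialHomeomorph M E} {f : E → E} {K : Set E}
    (hf : ∀ x ∉ K, f x = x) {q : M} (hq : q ∉ e.symm '' K) : chartConj e f q = q := by
  by_cases h : q ∈ e.source
  · rw [chartConj_of_mem h, hf, e.left_inv h]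
    exact fun hK => hq ⟨_, hK, e.left_inv h⟩
  · exact if_neg h

theorem chartConj_chartConj {e : OpenPartialHomeomorph M E} {f g : E → E}
    (hf : ∀ x ∈ e.target, f x ∈ e.target) (hgf : ∀ x, g (f x) = x) (q : M) :
    chartConj e g (chartConj e f q) = q := by
  by_cases h : q ∈ e.source
  · rw [chartConj_of_mem h, chartConj_of_mem (e.map_target (hf _ (e.map_source h))),
      e.right_inv (hf _ (e.map_source h)), hgf, e.left_inv h]
  · have : chartConj e f q = q := if_neg h
    rw [this]; exact if_neg h

variable [NormedSpace ℝ E]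

/-- On the chart domain the map is a composite of smooth maps. A point outside the domain has a
neighborhood on which the map is the identity, because the image of `K` in `M` is compact, hence
closed in a Hausdorff space. -/
theorem contMDiff_chartConj [T2Space M] [ChartedSpace E M] [IsManifold 𝓘(ℝ, E) ∞ M] (p : M)
    {f : E → E} (hs : ContDiff ℝ ∞ f) {K : Set E} (hK : IsCompact K)
    (hKt : K ⊆ (chartAt E p).target) (hf : ∀ x ∉ K, f x = x)
    (hft : ∀ x ∈ (chartAt E p).target, f x ∈ (chartAt E p).target) :
    ContMDiff 𝓘(ℝ, E) 𝓘(ℝ, E) ∞ (chartConj (chartAt E p) f) := by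
  intro q
  by_cases hq : q ∈ (chartAt E p).source
  · have h : ContMDiffOn 𝓘(ℝ, E) 𝓘(ℝ, E) ∞ (fun q => (chartAt E p).symm (f (chartAt E p q)))
        (chartAt E p).source :=
      (contMDiffOn_chart_symm (I := 𝓘(ℝ, E)) (n := ∞) (x := p)).comp
        (hs.contMDiff.comp_contMDiffOn (contMDiffOn_chart (I := 𝓘(ℝ, E)) (n := ∞) (x := p)))
        fun x hx => hft _ ((chartAt E p).map_source hx)
    have ho := (chartAt E p).open_source.mem_nhds hq
    exact (h.contMDiffAt ho).congr_of_eventuallyEq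
      (Filter.eventually_of_mem ho fun x hx => chartConj_of_mem hx)
  · have hc : IsClosed ((chartAt E p).symm '' K) :=
      (hK.image_of_continuousOn ((chartAt E p).continuousOn_symm.mono hKt)).isClosed
    have hm : q ∉ (chartAt E p).symm '' K := by
      rintro ⟨x, hx, rfl⟩
      exact hq ((chartAt E p).map_target (hKt hx))
    exact contMDiffAt_id.congr_of_eventuallyEq
      (Filter.eventually_of_mem (hc.isOpen_compl.mem_nhds hm) fun x hx => chartConj_eq_self hf hx)

/-- A diffeomorphism of the model space that is supported in a compact subset of the range of a chart
gives a diffeomorphism of the manifold. -/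
theorem exists_diffeomorph_chartConj [T2Space M] [ChartedSpace E M] [IsManifold 𝓘(ℝ, E) ∞ M] (p : M)
    (Φ : E ≃ₜ E) (hs : ContDiff ℝ ∞ Φ) (hs' : ContDiff ℝ ∞ Φ.symm) {K : Set E} (hK : IsCompact K)
    (hKt : K ⊆ (chartAt E p).target) (hf : ∀ x ∉ K, Φ x = x) :
    ∃ φ : M ≃ₘ^∞⟮𝓘(ℝ, E), 𝓘(ℝ, E)⟯ M, ∀ q, φ q = chartConj (chartAt E p) Φ q := by
  have hf' : ∀ x ∉ K, Φ.symm x = x := fun x hx => by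
    rw [Homeomorph.symm_apply_eq, hf x hx]
  -- If `Φ x ∉ K`, then `Φ` fixes `Φ x`, and injectivity gives `Φ x = x`.
  have ht : ∀ x ∈ (chartAt E p).target, Φ x ∈ (chartAt E p).target := fun x hx => by
    by_cases h : Φ x ∈ K
    · exact hKt h
    · have := hf _ h
      rwa [Φ.injective this]
  have ht' : ∀ x ∈ (chartAt E p).target, Φ.symm x ∈ (chartAt E p).target := fun x hx => by
    by_cases h : Φ.symm x ∈ K
    · exact hKt h
    · have := hf' _ h
      rwa [Φ.symm.injective this]
  exact ⟨{ toFun := chartConj (chartAt E p) Φ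
           invFun := chartConj (chartAt E p) Φ.symm
           left_inv := chartConj_chartConj ht Φ.symm_apply_apply
           right_inv := chartConj_chartConj ht' Φ.apply_symm_apply
           contMDiff_toFun := contMDiff_chartConj p hs hK hKt hf ht
           contMDiff_invFun := contMDiff_chartConj p hs' hK hKt hf' ht' }, fun _ => rfl⟩

/-- Around any point of a manifold there is a diffeomorphism that is, in the preferred chart, a given
quadratic perturbation of the identity near the point, and is supported away from another point. -/
theorem exists_diffeomorph_quadratic [FiniteDimensional ℝ E] [T2Space M] [ChartedSpace E M]
    [IsManifold 𝓘(ℝ, E) ∞ M] (p : M) (Q : E →L[ℝ] E →L[ℝ] E) :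
    ∀ q : M, ∃ φ : M ≃ₘ^∞⟮𝓘(ℝ, E), 𝓘(ℝ, E)⟯ M,
      (∀ᶠ x in 𝓝 (chartAt E p p), φ ((chartAt E p).symm x) = (chartAt E p).symm
        (x + (2⁻¹ : ℝ) • Q (x - chartAt E p p) (x - chartAt E p p))) ∧
      (q ≠ p → ∀ᶠ x in 𝓝 q, φ x = x) := by
  intro q
  set e := chartAt E p
  set x₀ := e p
  have : CompleteSpace E := FiniteDimensional.complete ℝ E
  let η : ContDiffBump (0 : E) := ⟨1, 2, by norm_num, by norm_num⟩
  let h : E → E := fun y => η y • ((2⁻¹ : ℝ) • Q y y)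
  have hh : ContDiff ℝ ∞ h := η.contDiff.smul
    (contDiff_const.smul (Q.contDiff.clm_apply contDiff_id))
  have hsupp : HasCompactSupport h := η.hasCompactSupport.smul_right
  obtain ⟨C, hC⟩ := ContDiff.lipschitzWith_of_hasCompactSupport hsupp hh (by simp)
  have hp : x₀ ∈ e.target := e.map_source (mem_chart_source E p)
  -- The support has to stay inside the range of the chart and, when `q ≠ p`, away from `q`.
  have hU : ∀ᶠ x in 𝓝 x₀, x ∈ e.target ∧ (q ≠ p → e.symm x ≠ q) := by
    refine (e.open_target.eventually_mem hp).and ?_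
    by_cases hq : q = p
    · simp [hq]
    · have hc : Filter.Tendsto e.symm (𝓝 x₀) (𝓝 p) := by
        have := (e.continuousAt_symm hp).tendsto
        rwa [e.left_inv (mem_chart_source E p)] at this
      exact (hc.eventually_ne (Ne.symm hq)).mono fun x hx _ => hx
  obtain ⟨δ, hδ, hδU⟩ := Metric.eventually_nhds_iff_ball.1 hU
  -- The bump has outer radius 2, so `2 * r < δ` confines the rescaled support to the good ball; `r
  -- * C < 1` makes the rescaled perturbation a contraction.
  obtain ⟨r, hr, hrδ, hrC⟩ : ∃ r : ℝ, 0 < r ∧ 2 * r < δ ∧ r * C < 1 := by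
    refine ⟨min (δ / 3) (1 / (C + 1)), lt_min (by positivity) (by positivity), ?_, ?_⟩
    · have := min_le_left (δ / 3) (1 / ((C : ℝ) + 1)); linarith
    · have h1 := min_le_right (δ / 3) (1 / ((C : ℝ) + 1))
      have h2 : (0 : ℝ) ≤ C := C.2
      calc _ ≤ 1 / ((C : ℝ) + 1) * C := by gcongr
        _ < 1 := by rw [one_div, inv_mul_lt_one₀ (by positivity)]; linarith
  -- Quadratic rescaling: where the bump is 1, the factor `r ^ 2` cancels the two factors `r⁻¹` and
  -- leaves `Q` unchanged, while the Lipschitz constant drops from `C` to `r * C`.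
  let g : E → E := fun x => r ^ 2 • h (r⁻¹ • (x - x₀))
  have hg : ContDiff ℝ ∞ g := contDiff_const.smul
    (hh.comp (contDiff_const.smul (contDiff_id.sub contDiff_const)))
  have hgL : LipschitzWith ⟨r * C, by positivity⟩ g := by
    refine LipschitzWith.of_dist_le_mul fun x y => ?_
    have h1 := hC.dist_le_mul (r⁻¹ • (x - x₀)) (r⁻¹ • (y - x₀))
    change dist (r ^ 2 • h _) (r ^ 2 • h _) ≤ r * C * dist x y
    rw [dist_smul₀, dist_sub_right] at h1
    rw [dist_smul₀]
    simp only [Real.norm_eq_abs, abs_of_pos hr, abs_of_pos (pow_pos hr 2), abs_inv] at h1 ⊢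
    calc _ ≤ r ^ 2 * (C * (r⁻¹ * dist x y)) := by gcongr
      _ = _ := by field_simp
  obtain ⟨Φ, hΦ, hs, hs'⟩ := exists_homeomorph_id_add hg (K := ⟨r * C, by positivity⟩) hrC hgL
  have hKδ : Metric.closedBall x₀ (2 * r) ⊆ Metric.ball x₀ δ :=
    Metric.closedBall_subset_ball hrδ
  have hf : ∀ x ∉ Metric.closedBall x₀ (2 * r), Φ x = x := fun x hx => by
    rw [hΦ, add_eq_left]
    have h0 : η (r⁻¹ • (x - x₀)) = 0 := by
      refine η.zero_of_le_dist ?_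
      change 2 ≤ _
      rw [dist_zero_right, norm_smul, norm_inv, Real.norm_eq_abs, abs_of_pos hr,
        le_inv_mul_iff₀ hr]
      rw [Metric.mem_closedBall, dist_eq_norm, not_le] at hx
      linarith
    simp [g, h, h0]
  obtain ⟨φ, hφ⟩ := exists_diffeomorph_chartConj p Φ hs hs' (isCompact_closedBall x₀ (2 * r))
    (fun x hx => (hδU x (hKδ hx)).1) hf
  refine ⟨φ, ?_, fun hq => ?_⟩
  · filter_upwards [e.open_target.mem_nhds hp, Metric.ball_mem_nhds x₀ hr] with x hx hxr
    rw [hφ, chartConj_of_mem (e.map_target hx), e.right_inv hx, hΦ]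
    have h1 : η (r⁻¹ • (x - x₀)) = 1 := by
      refine η.one_of_mem_closedBall ?_
      change _ ∈ Metric.closedBall 0 1
      rw [mem_closedBall_zero_iff, norm_smul, norm_inv, Real.norm_eq_abs, abs_of_pos hr,
        inv_mul_le_iff₀ hr]
      rw [Metric.mem_ball, dist_eq_norm] at hxr
      linarith
    have h2 : g x = (2⁻¹ : ℝ) • Q (x - x₀) (x - x₀) := by
      simp only [g, h, h1, map_smul, smul_smul, smul_apply]
      congr 1
      field_simp
    rw [h2]
  · have hc : IsClosed (e.symm '' Metric.closedBall x₀ (2 * r)) :=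
      ((isCompact_closedBall x₀ (2 * r)).image_of_continuousOn (e.continuousOn_symm.mono
        fun x hx => (hδU x (hKδ hx)).1)).isClosed
    refine Filter.eventually_of_mem (hc.isOpen_compl.mem_nhds ?_) fun x hx =>
      (hφ x).trans (chartConj_eq_self hf hx)
    rintro ⟨x, hx, hxq⟩
    exact (hδU x (hKδ hx)).2 hq hxq

end Transport

/-! ### Nondegeneracy of Lorentz forms and the algebra of Christoffel symbols -/

namespace SymForm

variable {E : Type*} [NormedAddCommGroup E] [NormedSpace ℝ E]

theorem add_left (g : SymForm E) (v v' w : E) :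
    g.1 ![v + v', w] = g.1 ![v, w] + g.1 ![v', w] := g.1.cons_add ![w] v v'

theorem smul_left (g : SymForm E) (c : ℝ) (v w : E) :
    g.1 ![c • v, w] = c * g.1 ![v, w] := g.1.cons_smul ![w] c v

theorem symm (g : SymForm E) (v w : E) : g.1 ![v, w] = g.1 ![w, v] := g.2 v w

theorem add_right (g : SymForm E) (v w w' : E) :
    g.1 ![v, w + w'] = g.1 ![v, w] + g.1 ![v, w'] := by
  rw [g.symm, add_left, g.symm w, g.symm w']

theorem smul_right (g : SymForm E) (c : ℝ) (v w : E) :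
    g.1 ![v, c • w] = c * g.1 ![v, w] := by
  rw [g.symm, smul_left, g.symm w]

/-- The evaluation of symmetric forms at two vectors. -/
noncomputable def eval (v w : E) : SymForm E →L[ℝ] ℝ :=
  (ContinuousMultilinearMap.apply ℝ (fun _ : Fin 2 => E) ℝ ![v, w]).comp (incl E)

variable [FiniteDimensional ℝ E]

/-- Write `x = a + n` along a positive line and a negative definite complement. Pairing `x` with `a`
and with `n` gives `g (a, a) = g (n, n)`, where the left side is nonnegative and the right side
nonpositive; so both vanish and definiteness gives `a = n = 0`. -/
theorem IsLorentz.eq_zero (hE : Module.finrank ℝ E = 4) {g : SymForm E} (hg : g.IsLorentz) {x : E}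
    (hx : ∀ y, g.1 ![x, y] = 0) : x = 0 := by
  obtain ⟨P, N, hP, hN, hP', hN'⟩ := (isLorentz_iff hE g).1 hg
  have hd : Disjoint P N := by
    rw [Submodule.disjoint_def]
    intro v h₁ h₂
    by_contra h0
    have := hP' v h₁ h0
    have := hN' v h₂ h0
    linarith
  have hsup : P ⊔ N = ⊤ := by
    apply Submodule.eq_top_of_finrank_eq
    have := Submodule.finrank_sup_add_finrank_inf_eq P N
    rw [hd.eq_bot, finrank_bot] at this
    omega
  obtain ⟨a, ha, n, hn, rfl⟩ := Submodule.mem_sup.1 (hsup ▸ Submodule.mem_top : x ∈ P ⊔ N)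
  have h₁ := hx a
  have h₂ := hx n
  rw [add_left] at h₁ h₂
  rw [g.symm n a] at h₁
  have ha0 : a = 0 := by
    by_contra h0
    have := hP' a ha h0
    by_cases h : n = 0
    · subst h
      have h3 : g.1 ![a, (0 : E)] = 0 := by simpa using g.smul_right 0 a 0
      linarith
    · have := hN' n hn h
      linarith
  have hn0 : n = 0 := by
    by_contra h0
    have := hN' n hn h0
    subst ha0
    have h3 : g.1 ![(0 : E), n] = 0 := by simpa using g.smul_left 0 0 n
    linarith
  rw [ha0, hn0, add_zero]

/-- Raising an index: the map from `E` to its dual given by `g` is injective by nondegeneracy, hence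
bijective by dimension. -/
theorem IsLorentz.exists_eq (hE : Module.finrank ℝ E = 4) {g : SymForm E} (hg : g.IsLorentz)
    (f : E →ₗ[ℝ] ℝ) : ∃ x, ∀ y, g.1 ![x, y] = f y := by
  let Φ : E →ₗ[ℝ] Module.Dual ℝ E := LinearMap.mk₂ ℝ (fun v w => g.1 ![v, w]) g.add_left
    g.smul_left g.add_right g.smul_right
  have hi : Function.Injective Φ := (injective_iff_map_eq_zero Φ).2 fun x hx =>
    hg.eq_zero hE fun y => DFunLike.congr_fun hx y
  have hs : Function.Surjective Φ :=
    (LinearMap.injective_iff_surjective_of_finrank_eq_finrank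
      Subspace.dual_finrank_eq.symm).1 hi
  obtain ⟨x, hx⟩ := hs f
  exact ⟨x, fun y => DFunLike.congr_fun hx y⟩

/-- The algebraic lemma behind the existence and uniqueness of the Levi-Civita connection. -/
theorem IsLorentz.exists_christoffel (hE : Module.finrank ℝ E = 4) {g : SymForm E}
    (hg : g.IsLorentz) (D : E →L[ℝ] SymForm E) :
    ∃ Q : E →L[ℝ] E →L[ℝ] E, (∀ v a, Q v a = Q a v) ∧
      ∀ v a b, (D v).1 ![a, b] = g.1 ![Q v a, b] + g.1 ![a, Q v b] := by
  have hDa : ∀ v v' a b, (D (v + v')).1 ![a, b] = (D v).1 ![a, b] + (D v').1 ![a, b] :=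
    fun v v' a b => by rw [map_add]; rfl
  have hDs : ∀ (c : ℝ) v a b, (D (c • v)).1 ![a, b] = c * (D v).1 ![a, b] :=
    fun c v a b => by rw [map_smul]; rfl
  -- Koszul formula: `Q v a` is defined by its pairings with all `b`.
  have hex : ∀ v a, ∃ x, ∀ b, g.1 ![x, b] =
      2⁻¹ * ((D v).1 ![a, b] + (D a).1 ![v, b] - (D b).1 ![v, a]) := fun v a =>
    hg.exists_eq hE
      { toFun := fun b => 2⁻¹ * ((D v).1 ![a, b] + (D a).1 ![v, b] - (D b).1 ![v, a])
        map_add' := fun b b' => by simp only [add_right, hDa]; ring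
        map_smul' := fun c b => by simp only [smul_right, hDs, RingHom.id_apply, smul_eq_mul]; ring }
  choose q hq using hex
  have hinj : ∀ x y : E, (∀ b, g.1 ![x, b] = g.1 ![y, b]) → x = y := fun x y h => by
    rw [← sub_eq_zero]
    refine hg.eq_zero hE fun b => ?_
    have h1 : x - y = x + (-1 : ℝ) • y := by simp [sub_eq_add_neg]
    rw [h1, add_left, smul_left, h]; ring
  -- The pointwise choice `q` is bilinear because its values are determined by their pairings.
  let Q := LinearMap.mk₂ ℝ q
    (fun v v' a => hinj _ _ fun b => by simp only [add_left, hq, hDa]; ring)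
    (fun c v a => hinj _ _ fun b => by simp only [smul_left, hq, hDs]; ring)
    (fun v a a' => hinj _ _ fun b => by simp only [add_left, hq, hDa, add_right]; ring)
    (fun c v a => hinj _ _ fun b => by simp only [smul_left, hq, hDs, smul_right]; ring)
  have hQ : ∀ v a, Q.toContinuousBilinearMap v a = q v a := fun _ _ => rfl
  refine ⟨Q.toContinuousBilinearMap, fun v a => hinj _ _ fun b => ?_, fun v a b => ?_⟩
  · rw [hQ, hQ, hq, hq, (D b).symm v a]; ring
  · rw [hQ, hQ, hq, g.symm a, hq, (D v).symm b a]; ring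

end SymForm

/-! ### Effect of a quadratic coordinate change on first derivatives -/

section Quadratic

variable {E : Type*} [NormedAddCommGroup E] [NormedSpace ℝ E]

/-- The quadratic perturbation of the identity around `x₀`. -/
noncomputable def quadMap (x₀ : E) (Q : E →L[ℝ] E →L[ℝ] E) (x : E) : E :=
  x + (2⁻¹ : ℝ) • Q (x - x₀) (x - x₀)

theorem quadMap_self (x₀ : E) (Q : E →L[ℝ] E →L[ℝ] E) : quadMap x₀ Q x₀ = x₀ := by
  simp [quadMap]

theorem contDiff_quadMap (x₀ : E) (Q : E →L[ℝ] E →L[ℝ] E) : ContDiff ℝ ∞ (quadMap x₀ Q) :=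
  contDiff_id.add (contDiff_const.smul ((Q.contDiff.comp (contDiff_id.sub contDiff_const)).clm_apply
    (contDiff_id.sub contDiff_const)))

/-- By symmetry of `Q` the two terms of the product rule coincide, which cancels the factor 1/2. In
particular the derivative at `x₀` is the identity. -/
theorem hasFDerivAt_quadMap (x₀ : E) {Q : E →L[ℝ] E →L[ℝ] E} (hQ : ∀ v a, Q v a = Q a v) (x : E) :
    HasFDerivAt (quadMap x₀ Q) (.id ℝ E + Q (x - x₀)) x := by
  have h₁ : HasFDerivAt (fun x => x - x₀) (.id ℝ E) x := (hasFDerivAt_id x).sub_const x₀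
  have h₂ : HasFDerivAt (fun x => Q (x - x₀)) (Q.comp (.id ℝ E)) x := Q.hasFDerivAt.comp x h₁
  refine ((hasFDerivAt_id x).add ((h₂.clm_apply h₁).const_smul (2⁻¹ : ℝ))).congr_fderiv ?_
  ext v
  simp only [_root_.add_apply, _root_.smul_apply,
    ContinuousLinearMap.comp_apply, ContinuousLinearMap.id_apply, ContinuousLinearMap.flip_apply]
  rw [hQ v, ← two_smul ℝ, smul_smul]
  norm_num

theorem fderiv_quadMap (x₀ : E) {Q : E →L[ℝ] E →L[ℝ] E} (hQ : ∀ v a, Q v a = Q a v) (x : E) :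
    fderiv ℝ (quadMap x₀ Q) x = .id ℝ E + Q (x - x₀) := (hasFDerivAt_quadMap x₀ hQ x).fderiv

theorem differentiableAt_pull_quadMap {x₀ : E} {Q : E →L[ℝ] E →L[ℝ] E} {w : E → SymForm E}
    (hw : DifferentiableAt ℝ w x₀) :
    DifferentiableAt ℝ
      (fun y => SymForm.pull (fderiv ℝ (quadMap x₀ Q) y) (w (quadMap x₀ Q y))) x₀ := by
  have h₁ : ContDiff ℝ ∞ (fun y => SymForm.pull (fderiv ℝ (quadMap x₀ Q) y)) :=
    SymForm.contDiff_pull.comp ((contDiff_quadMap x₀ Q).fderiv_right (by simp))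
  have h₂ : DifferentiableAt ℝ (fun y => w (quadMap x₀ Q y)) x₀ := by
    refine DifferentiableAt.comp x₀ ?_ (((contDiff_quadMap x₀ Q).differentiable (by simp)) x₀)
    rwa [quadMap_self]
  exact ((h₁.differentiable (by simp)) x₀).clm_apply h₂

/-- The change of the first derivatives of a symmetric form under pullback by a quadratic perturbation
of the identity. -/
theorem fderiv_pull_quadMap {x₀ : E} {Q : E →L[ℝ] E →L[ℝ] E} (hQ : ∀ v a, Q v a = Q a v)
    {w : E → SymForm E} (hw : DifferentiableAt ℝ w x₀) (v a b : E) :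
    (fderiv ℝ (fun y => SymForm.pull (fderiv ℝ (quadMap x₀ Q) y) (w (quadMap x₀ Q y))) x₀ v).1
      ![a, b] = (fderiv ℝ w x₀ v).1 ![a, b] + (w x₀).1 ![Q v a, b] + (w x₀).1 ![a, Q v b] := by
  have hl : HasDerivAt (fun t : ℝ => x₀ + t • v) v 0 := by
    simpa using ((hasDerivAt_id (0 : ℝ)).smul_const v).const_add x₀
  have e₀ : x₀ + (0 : ℝ) • v = x₀ := by simp
  have hz := (SymForm.eval a b).hasFDerivAt.comp_hasDerivAt (0 : ℝ)
    (HasFDerivAt.comp_hasDerivAt (0 : ℝ)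
      (by rw [e₀]; exact (differentiableAt_pull_quadMap (Q := Q) hw).hasFDerivAt) hl)
  have hF : HasDerivAt (fun t : ℝ => w (quadMap x₀ Q (x₀ + t • v))) (fderiv ℝ w x₀ v) 0 := by
    have h₁ : HasDerivAt (fun t : ℝ => quadMap x₀ Q (x₀ + t • v)) v 0 := by
      have := HasFDerivAt.comp_hasDerivAt (0 : ℝ)
        (hasFDerivAt_quadMap x₀ hQ (x₀ + (0 : ℝ) • v)) hl
      have e : ((.id ℝ E : E →L[ℝ] E) + Q (x₀ + (0 : ℝ) • v - x₀)) v = v := by simp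
      rwa [e] at this
    exact HasFDerivAt.comp_hasDerivAt (0 : ℝ)
      (by rw [e₀, quadMap_self]; exact hw.hasFDerivAt) h₁
  have hev : ∀ c d : E, HasDerivAt (fun t : ℝ => (w (quadMap x₀ Q (x₀ + t • v))).1 ![c, d])
      ((fderiv ℝ w x₀ v).1 ![c, d]) 0 := fun c d =>
    (SymForm.eval c d).hasFDerivAt.comp_hasDerivAt (0 : ℝ) hF
  have hid := hasDerivAt_id (0 : ℝ)
  -- Along `x₀ + t • v` the derivative of `quadMap` is exactly `id + t • Q v`, so the pulled-back
  -- form at `(a, b)` expands into four terms with factors 1, `t`, `t` and `t ^ 2`. At `t = 0` the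
  -- last one contributes nothing, and the middle two contribute only their coefficients.
  have hsum := (((hev a b).add (hid.mul (hev (Q v a) b))).add (hid.mul (hev a (Q v b)))).add
    ((hid.mul hid).mul (hev (Q v a) (Q v b)))
  have heq := hz.unique (hsum.congr_of_eventuallyEq (Filter.Eventually.of_forall fun t => ?_))
  · simp only [id, e₀, quadMap_self, one_mul, zero_mul, add_zero, Pi.mul_apply] at heq
    exact heq
  · change (SymForm.pull _ _).1 ![a, b] = _
    rw [SymForm.pull_apply, fderiv_quadMap x₀ hQ]
    simp only [add_sub_cancel_left, map_smul, _root_.add_apply,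
      _root_.smul_apply, ContinuousLinearMap.id_apply, SymForm.add_left,
      SymForm.add_right, SymForm.smul_left, SymForm.smul_right, Pi.add_apply, Pi.mul_apply, id]
    ring

end Quadratic

/-! ### Tangent maps and transport of tensors in the chart at a point -/

section Charts

variable {E W : Type*} [NormedAddCommGroup E] [NormedSpace ℝ E]
  [NormedAddCommGroup W] [NormedSpace ℝ W] {M : Type*} [TopologicalSpace M] [ChartedSpace E M]

/-- As `p` is fixed, source and target are read in the same preferred chart, where the map is `F`
near the image of `p`. -/
theorem mfderiv_of_chart_eq {φ : M → M} {p : M} (hφ : MDifferentiableAt 𝓘(ℝ, E) 𝓘(ℝ, E) φ p)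
    (hp : φ p = p) {F : E → E} (hF : ContinuousAt F (chartAt E p p))
    (hFp : F (chartAt E p p) = chartAt E p p)
    (h : ∀ᶠ x in 𝓝 (chartAt E p p), φ ((chartAt E p).symm x) = (chartAt E p).symm (F x)) :
    (mfderiv 𝓘(ℝ, E) 𝓘(ℝ, E) φ p : E →L[ℝ] E) = fderiv ℝ F (chartAt E p p) := by
  refine hφ.mfderiv.trans ?_
  have e : writtenInExtChartAt 𝓘(ℝ, E) 𝓘(ℝ, E) p φ =ᶠ[𝓝 (chartAt E p p)] F := by
    have ht : ∀ᶠ x in 𝓝 (chartAt E p p), F x ∈ (chartAt E p).target := by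
      refine hF.eventually_mem ?_
      rw [hFp]
      exact (chartAt E p).open_target.mem_nhds ((chartAt E p).map_source (mem_chart_source E p))
    filter_upwards [h, ht] with x hx hxt
    change chartAt E (φ p) (φ ((chartAt E p).symm x)) = F x
    rw [hp, hx, (chartAt E p).right_inv hxt]
  simp only [modelWithCornersSelf_coe, Set.range_id, fderivWithin_univ]
  exact e.fderiv_eq

variable [IsManifold 𝓘(ℝ, E) ∞ M]

/-- The tangent space at `x` is represented in the preferred chart at `x`, so the tangent map of the
inverse chart at `p` is the derivative of a chart transition. This turns coordinate changes into
tangent maps, to which the chain rule applies. -/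
theorem tangentCoordChange_eq_mfderiv_symm (p : M) {y : E} (hy : y ∈ (chartAt E p).target) {x : M}
    (hx : (chartAt E p).symm y = x) :
    (tangentBundleCore 𝓘(ℝ, E) M).coordChange (achart E p) (achart E x) x =
      (mfderiv 𝓘(ℝ, E) 𝓘(ℝ, E) (chartAt E p).symm y : E →L[ℝ] E) := by
  subst hx
  have hd : MDifferentiableAt 𝓘(ℝ, E) 𝓘(ℝ, E) (chartAt E p).symm y :=
    ((contMDiffOn_chart_symm (I := 𝓘(ℝ, E)) (n := ∞) (x := p)).contMDiffAt
      ((chartAt E p).open_target.mem_nhds hy)).mdifferentiableAt (by simp)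
  refine Eq.trans ?_ hd.mfderiv.symm
  rw [tangentBundleCore_coordChange_achart]
  have e : extChartAt 𝓘(ℝ, E) p ((chartAt E p).symm y) = y := (chartAt E p).right_inv hy
  rw [e]
  rfl

theorem TensorialAction.trivializationAt_snd (ρ : TensorialAction E W) (p : M)
    (u : ρ.Total 𝓘(ℝ, E) M) :
    (trivializationAt W (ρ.core 𝓘(ℝ, E) M).Fiber p u).2 =
      ρ.act ((tangentBundleCore 𝓘(ℝ, E) M).coordChange (achart E u.1) (achart E p) u.1)
        ((tangentBundleCore 𝓘(ℝ, E) M).coordChange (achart E p) (achart E u.1) u.1) u.2 := rfl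

/-- The coordinate expression of the transport of a symmetric form. -/
theorem SymForm.trivializationAt_push_snd (p : M) (φ : M ≃ₘ^∞⟮𝓘(ℝ, E), 𝓘(ℝ, E)⟯ M)
    (u : (SymForm.action E).Total 𝓘(ℝ, E) M) (hu : u.1 ∈ (chartAt E p).source) {y : E}
    (hy : y ∈ (chartAt E p).target) (hφ : (chartAt E p).symm y = φ u.1)
    {F : E → E} (hF : DifferentiableAt ℝ F y) (hFy : F y = chartAt E p u.1)
    (h : ∀ᶠ x in 𝓝 y, φ.symm ((chartAt E p).symm x) = (chartAt E p).symm (F x)) :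
    (trivializationAt (SymForm E) ((SymForm.action E).core 𝓘(ℝ, E) M).Fiber p
      ((SymForm.action E).push φ u)).2 =
    SymForm.pull (fderiv ℝ F y)
      (trivializationAt (SymForm E) ((SymForm.action E).core 𝓘(ℝ, E) M).Fiber p u).2 := by
  set e := chartAt E p with he
  have hd : ∀ z ∈ e.target, HasMFDerivAt 𝓘(ℝ, E) 𝓘(ℝ, E) e.symm z
      (mfderiv 𝓘(ℝ, E) 𝓘(ℝ, E) e.symm z) := fun z hz =>
    (((contMDiffOn_chart_symm (I := 𝓘(ℝ, E)) (n := ∞) (x := p)).contMDiffAt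
      (e.open_target.mem_nhds hz)).mdifferentiableAt (by simp)).hasMFDerivAt
  have hFt : F y ∈ e.target := hFy ▸ e.map_source hu
  have hFu : e.symm (F y) = u.1 := by rw [hFy, e.left_inv hu]
  have h₁ : HasMFDerivAt 𝓘(ℝ, E) 𝓘(ℝ, E) φ.symm (e.symm y)
      (mfderiv 𝓘(ℝ, E) 𝓘(ℝ, E) φ.symm (φ u.1) : E →L[ℝ] E) := by
    rw [hφ]
    exact ((φ.symm.mdifferentiable (by simp)) (φ u.1)).hasMFDerivAt
  have h₂ := h₁.comp y (hd y hy)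
  have h₃ := (hd _ hFt).comp y hF.hasFDerivAt.hasMFDerivAt
  -- Differentiate `φ⁻¹ ∘ e⁻¹ = e⁻¹ ∘ F` at `y` by the chain rule on both sides.
  have key : (mfderiv 𝓘(ℝ, E) 𝓘(ℝ, E) φ.symm (φ u.1) : E →L[ℝ] E) ∘L
      (mfderiv 𝓘(ℝ, E) 𝓘(ℝ, E) e.symm y : E →L[ℝ] E) =
      (mfderiv 𝓘(ℝ, E) 𝓘(ℝ, E) e.symm (F y) : E →L[ℝ] E) ∘L fderiv ℝ F y :=
    hasMFDerivAt_unique h₂ (h₃.congr_of_eventuallyEq h)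
  rw [TensorialAction.trivializationAt_snd, TensorialAction.trivializationAt_snd]
  change SymForm.pull ((tangentBundleCore 𝓘(ℝ, E) M).coordChange (achart E p)
      (achart E (φ u.1)) (φ u.1)) (SymForm.pull (E := E) (mfderiv 𝓘(ℝ, E) 𝓘(ℝ, E) φ.symm (φ u.1)) u.2) =
    SymForm.pull (fderiv ℝ F y) (SymForm.pull ((tangentBundleCore 𝓘(ℝ, E) M).coordChange
      (achart E p) (achart E u.1) u.1) u.2)
  rw [tangentCoordChange_eq_mfderiv_symm p hy hφ, tangentCoordChange_eq_mfderiv_symm p hFt hFu]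
  exact congrArg (fun A : E →L[ℝ] E => SymForm.pull A u.2) key

/-- Transport of a tensor involves no second derivatives of `φ`, whereas transport of a 1-jet of
metrics does; the theorem rests on this difference. -/
theorem TensorialAction.push_eq_self_of_mfderiv (ρ : TensorialAction E W)
    (φ : M ≃ₘ^∞⟮𝓘(ℝ, E), 𝓘(ℝ, E)⟯ M) (u : ρ.Total 𝓘(ℝ, E) M) (hx : φ u.1 = u.1)
    (h₁ : (mfderiv 𝓘(ℝ, E) 𝓘(ℝ, E) φ u.1 : E →L[ℝ] E) = .id ℝ E)
    (h₂ : (mfderiv 𝓘(ℝ, E) 𝓘(ℝ, E) φ.symm u.1 : E →L[ℝ] E) = .id ℝ E) : ρ.push φ u = u := by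
  obtain ⟨x, w⟩ := u
  have h₃ : (mfderiv 𝓘(ℝ, E) 𝓘(ℝ, E) φ.symm (φ x) : E →L[ℝ] E) = .id ℝ E := by
    have hc : ∀ y, y = x → (mfderiv 𝓘(ℝ, E) 𝓘(ℝ, E) φ.symm y : E →L[ℝ] E) = .id ℝ E := by
      rintro y rfl; exact h₂
    exact hc _ hx
  have h₄ : ρ.act (mfderiv 𝓘(ℝ, E) 𝓘(ℝ, E) φ x) (mfderiv 𝓘(ℝ, E) 𝓘(ℝ, E) φ.symm (φ x)) w = w := by
    have hc : ∀ A B : E →L[ℝ] E, A = .id ℝ E → B = .id ℝ E → ρ.act A B w = w := by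
      rintro _ _ rfl rfl; exact DFunLike.congr_fun ρ.act_id w
    exact hc _ _ h₁ h₃
  exact congrArg₂ (fun (y : M) (v : W) => (⟨y, v⟩ : ρ.Total 𝓘(ℝ, E) M)) hx h₄

end Charts

/-! ### Transitivity on the jets over a given metric value -/

section MetricJets

variable {M : Type*} [TopologicalSpace M] [ChartedSpace (EuclideanSpace ℝ (Fin 4)) M]
  [IsManifold (𝓡 4) ∞ M]

/-- The fiber coordinate of a point of the bundle of Lorentz metrics in the preferred chart at `p`. -/
noncomputable def fiberCoord (p : M) (u : MetricBundle M) : SymForm (EuclideanSpace ℝ (Fin 4)) :=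
  (trivializationAt (SymForm (EuclideanSpace ℝ (Fin 4)))
    ((SymForm.action (EuclideanSpace ℝ (Fin 4))).core (𝓡 4) M).Fiber p u.1).2

/-- Passing to the chart at `p` is a congruence by an invertible coordinate change, which preserves
the signature. -/
theorem isLorentz_fiberCoord (p : M) (b : MetricBundle M)
    (h₀ : b.1.1 ∈ (chartAt (EuclideanSpace ℝ (Fin 4)) p).source) : (fiberCoord p b).IsLorentz := by
  set T := tangentBundleCore (𝓡 4) M
  refine (SymForm.isLorentz_pull_iff
    (B := T.coordChange (achart _ p) (achart _ b.1.1) b.1.1)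
    (B' := T.coordChange (achart _ b.1.1) (achart _ p) b.1.1) ?_ ?_).2 b.2
  · ext1 v
    exact (T.coordChange_comp _ _ _ _ ⟨⟨mem_chart_source _ _, h₀⟩, mem_chart_source _ _⟩ v).trans
      (T.coordChange_self _ _ (mem_chart_source _ _) v)
  · ext1 v
    exact (T.coordChange_comp _ _ _ _ ⟨⟨h₀, mem_chart_source _ _⟩, h₀⟩ v).trans
      (T.coordChange_self _ _ h₀ v)

/-- The coordinate expression of a section of the bundle of Lorentz metrics. -/
noncomputable def sectionCoord (p : M) (γ : M → MetricBundle M) (x : EuclideanSpace ℝ (Fin 4)) :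
    SymForm (EuclideanSpace ℝ (Fin 4)) :=
  fiberCoord p (γ ((chartAt (EuclideanSpace ℝ (Fin 4)) p).symm x))

theorem extChartAt_metricBundle (b u : MetricBundle M) : extChartAt metricModel b u =
    (chartAt (EuclideanSpace ℝ (Fin 4)) b.1.1
      (trivializationAt (SymForm (EuclideanSpace ℝ (Fin 4)))
        ((SymForm.action (EuclideanSpace ℝ (Fin 4))).core (𝓡 4) M).Fiber b.1.1 u.1).1,
      fiberCoord b.1.1 u) := rfl

/-- Since `γ p` lies over `p`, the preferred chart of the bundle there is built from the chart at
`p`. In it the section is the graph of `sectionCoord p γ`, so the only free data of its jet are the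
value and the derivative of the coefficients. -/
theorem isLocalSection_differentiableAt {γ : M → MetricBundle M} {p : M}
    (h : IsLocalSection (metricProjection M) γ p) :
    DifferentiableAt ℝ (sectionCoord p γ) (chartAt (EuclideanSpace ℝ (Fin 4)) p p) ∧
    (mfderiv (𝓡 4) metricModel γ p : EuclideanSpace ℝ (Fin 4) →L[ℝ]
      EuclideanSpace ℝ (Fin 4) × SymForm (EuclideanSpace ℝ (Fin 4))) =
      (ContinuousLinearMap.id ℝ _).prod
        (fderiv ℝ (sectionCoord p γ) (chartAt (EuclideanSpace ℝ (Fin 4)) p p)) := by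
  obtain ⟨hγ, hp⟩ := h.self_of_nhds
  have hp' : (γ p).1.1 = p := hp
  set e := chartAt (EuclideanSpace ℝ (Fin 4)) p
  have hd : MDifferentiableAt (𝓡 4) metricModel γ p := hγ.mdifferentiableAt (by simp)
  have ht : e p ∈ e.target := e.map_source (mem_chart_source _ p)
  have hc : Filter.Tendsto e.symm (𝓝 (e p)) (𝓝 p) := by
    have := (e.continuousAt_symm ht).tendsto
    rwa [e.left_inv (mem_chart_source _ p)] at this
  have hw : writtenInExtChartAt (𝓡 4) metricModel p γ =ᶠ[𝓝 (e p)]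
      fun x => (x, sectionCoord p γ x) := by
    filter_upwards [hc.eventually h, e.open_target.mem_nhds ht] with x hx hxt
    change extChartAt metricModel (γ p) (γ (e.symm x)) = _
    rw [extChartAt_metricBundle, hp']
    have h₁ : (γ (e.symm x)).1.1 = e.symm x := hx.2
    have h₂ : (trivializationAt (SymForm (EuclideanSpace ℝ (Fin 4)))
        ((SymForm.action (EuclideanSpace ℝ (Fin 4))).core (𝓡 4) M).Fiber p (γ (e.symm x)).1).1 =
        e.symm x := h₁
    rw [h₂]
    exact congrArg₂ Prod.mk (e.right_inv hxt) rfl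
  have hdw : DifferentiableAt ℝ (writtenInExtChartAt (𝓡 4) metricModel p γ) (e p) := by
    have := hd.differentiableWithinAt_writtenInExtChartAt
    simpa [differentiableWithinAt_univ] using this
  have hs : DifferentiableAt ℝ (sectionCoord p γ) (e p) :=
    (hw.differentiableAt_iff.1 hdw).snd
  refine ⟨hs, ?_⟩
  refine hd.mfderiv.trans ?_
  simp only [modelWithCornersSelf_coe, Set.range_id, fderivWithin_univ]
  exact hw.fderiv_eq.trans (((hasFDerivAt_id (e p)).prodMk hs.hasFDerivAt).fderiv)

theorem jet_eq_of_fderiv_eq {γ₁ γ₂ : M → MetricBundle M} {p : M}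
    (h₁ : IsLocalSection (metricProjection M) γ₁ p) (h₂ : IsLocalSection (metricProjection M) γ₂ p)
    (h : γ₁ p = γ₂ p)
    (hd : fderiv ℝ (sectionCoord p γ₁) (chartAt (EuclideanSpace ℝ (Fin 4)) p p) =
      fderiv ℝ (sectionCoord p γ₂) (chartAt (EuclideanSpace ℝ (Fin 4)) p p)) :
    jet (metricProjection M) γ₁ p = jet (metricProjection M) γ₂ p := by
  refine congrArg₂ (fun (b : MetricBundle M) (L : EuclideanSpace ℝ (Fin 4) →L[ℝ]
    EuclideanSpace ℝ (Fin 4) × SymForm (EuclideanSpace ℝ (Fin 4))) =>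
      (⟨b, L⟩ : JetAmbient (metricProjection M))) h ?_
  rw [(isLocalSection_differentiableAt h₁).2, (isLocalSection_differentiableAt h₂).2, hd]

/-- Two jets of Lorentz metrics with the same value are related by a diffeomorphism that acts trivially
on the tensors at the base point, and is the identity near any other given point. -/
theorem exists_diffeomorph_prolong_eq [T2Space M] (u v : Jet1 (metricProjection M))
    (h : u.truncate = v.truncate) (q : M) :
    ∃ φ : M ≃ₘ^∞⟮𝓡 4, 𝓡 4⟯ M, (metricInduction M).prolong φ u = v ∧
      ((∀ᶠ x in 𝓝 q, φ x = x) ∨ (φ q = q ∧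
        (mfderiv (𝓡 4) (𝓡 4) φ q : EuclideanSpace ℝ (Fin 4) →L[ℝ] EuclideanSpace ℝ (Fin 4)) =
          .id ℝ _ ∧
        (mfderiv (𝓡 4) (𝓡 4) φ.symm q :
          EuclideanSpace ℝ (Fin 4) →L[ℝ] EuclideanSpace ℝ (Fin 4)) = .id ℝ _)) := by
  obtain ⟨_, γ₁, p, h₁, rfl⟩ := u
  obtain ⟨_, γ₂, p', h₂, rfl⟩ := v
  replace h : γ₁ p = γ₂ p' := h
  have hp₁ : (γ₁ p).1.1 = p := h₁.self_of_nhds.2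
  obtain rfl : p = p' := by
    have hp₂ : (γ₂ p').1.1 = p' := h₂.self_of_nhds.2
    rw [← hp₁, h, hp₂]
  set e := chartAt (EuclideanSpace ℝ (Fin 4)) p with he
  have hps : p ∈ e.source := mem_chart_source _ p
  have ht : e p ∈ e.target := e.map_source hps
  have hL : (fiberCoord p (γ₁ p)).IsLorentz := isLorentz_fiberCoord p (γ₁ p) (by rw [hp₁]; exact hps)
  -- `Q` absorbs the difference of the two first derivatives, measured with the common value of the
  -- metrics.
  obtain ⟨Q, hQ, hD⟩ := hL.exists_christoffel (by simp)
    (fderiv ℝ (sectionCoord p γ₂) (e p) - fderiv ℝ (sectionCoord p γ₁) (e p))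
  obtain ⟨ψ, hψ, hψq⟩ := exists_diffeomorph_quadratic p Q q
  have hψp : ψ p = p := by
    have := hψ.self_of_nhds
    simpa [e.left_inv hps] using this
  have hψp' : ψ.symm p = p := by
    have := ψ.symm_apply_apply p
    rwa [hψp] at this
  have hm : (mfderiv (𝓡 4) (𝓡 4) ψ p : EuclideanSpace ℝ (Fin 4) →L[ℝ] EuclideanSpace ℝ (Fin 4)) =
      .id ℝ _ := by
    refine (mfderiv_of_chart_eq ((ψ.mdifferentiable (by simp)) p) hψp
      (contDiff_quadMap (e p) Q).continuous.continuousAt (quadMap_self _ _) hψ).trans ?_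
    rw [fderiv_quadMap _ hQ, sub_self, map_zero, add_zero]
    rfl
  have hm' : (mfderiv (𝓡 4) (𝓡 4) ψ.symm p :
      EuclideanSpace ℝ (Fin 4) →L[ℝ] EuclideanSpace ℝ (Fin 4)) = .id ℝ _ := by
    have h3 := mfderiv_symm_comp ψ p
    have hc : ∀ y, y = p → ∀ A : EuclideanSpace ℝ (Fin 4) →L[ℝ] EuclideanSpace ℝ (Fin 4),
        A = .id ℝ _ → (mfderiv (𝓡 4) (𝓡 4) ψ.symm y :
        EuclideanSpace ℝ (Fin 4) →L[ℝ] EuclideanSpace ℝ (Fin 4)) ∘L A = .id ℝ _ →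
        (mfderiv (𝓡 4) (𝓡 4) ψ.symm p :
          EuclideanSpace ℝ (Fin 4) →L[ℝ] EuclideanSpace ℝ (Fin 4)) = .id ℝ _ := by
      rintro y rfl A rfl h; exact h
    exact hc _ hψp _ hm h3
  -- Pushing forward along `ψ⁻¹` is pulling back along `ψ`, so the inverse is the diffeomorphism
  -- that carries the first jet to the second.
  refine ⟨ψ.symm, ?_, ?_⟩
  · refine Subtype.ext ?_
    change (metricInduction M).prolongAmbient ψ.symm _ = _
    rw [Induction.prolongAmbient_jet _ _ h₁, hψp']
    have hsec := h₁.induced (metricInduction M) ψ.symm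
    rw [hψp'] at hsec
    have hval : (metricInduction M ψ.symm ∘ γ₁ ∘ ψ.symm.symm) p = γ₂ p := by
      change metricInduction M ψ.symm (γ₁ (ψ p)) = _
      rw [hψp, ← h]
      refine Subtype.ext (TensorialAction.push_eq_self_of_mfderiv _ ψ.symm _ ?_ ?_ ?_)
      · rw [hp₁, hψp']
      · rw [hp₁]; exact hm'
      · rw [hp₁]; exact hm
    refine jet_eq_of_fderiv_eq hsec h₂ hval ?_
    -- Near `e p` the transported section has as coefficients the pullback by `quadMap` of those of
    -- `γ₁`. The chart formula for `ψ` is needed around each nearby `y`, since it is differentiated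
    -- there.
    have hcoord : sectionCoord p (metricInduction M ψ.symm ∘ γ₁ ∘ ψ.symm.symm) =ᶠ[𝓝 (e p)]
        fun y => SymForm.pull (fderiv ℝ (quadMap (e p) Q) y)
          (sectionCoord p γ₁ (quadMap (e p) Q y)) := by
      have hc : Filter.Tendsto (fun y => e.symm (quadMap (e p) Q y)) (𝓝 (e p)) (𝓝 p) := by
        have h₄ := (contDiff_quadMap (e p) Q).continuous.tendsto (e p)
        rw [quadMap_self] at h₄
        have h₅ := (e.continuousAt_symm ht).tendsto
        rw [e.left_inv hps] at h₅
        exact h₅.comp h₄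
      have hqt : ∀ᶠ y in 𝓝 (e p), quadMap (e p) Q y ∈ e.target := by
        refine (contDiff_quadMap (e p) Q).continuous.continuousAt.eventually_mem ?_
        rw [quadMap_self]
        exact e.open_target.mem_nhds ht
      filter_upwards [e.open_target.mem_nhds ht, hqt, hc.eventually h₁, hψ.eventually_nhds]
        with y hy hqy hsy hψy
      have hψy' : ψ (e.symm y) = e.symm (quadMap (e p) Q y) := hψy.self_of_nhds
      have hbase : (γ₁ (e.symm (quadMap (e p) Q y))).1.1 = e.symm (quadMap (e p) Q y) := hsy.2
      change fiberCoord p (metricInduction M ψ.symm (γ₁ (ψ (e.symm y)))) = _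
      rw [hψy']
      refine SymForm.trivializationAt_push_snd p ψ.symm (γ₁ (e.symm (quadMap (e p) Q y))).1 ?_ hy ?_
        (((contDiff_quadMap (e p) Q).differentiable (by simp)) y) ?_ hψy
      · rw [hbase]; exact e.map_target hqy
      · rw [hbase, ← hψy', ψ.symm_apply_apply]
      · rw [hbase]; exact (e.right_inv hqy).symm
    rw [hcoord.fderiv_eq]
    ext1 v
    refine SymForm.ext_pair fun a b => ?_
    have hs₀ : sectionCoord p γ₁ (e p) = fiberCoord p (γ₁ p) := by
      rw [sectionCoord, e.left_inv hps]
    rw [fderiv_pull_quadMap hQ (isLocalSection_differentiableAt h₁).1, hs₀, add_assoc, ← hD]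
    change _ + ((_ : ℝ) - _) = _
    exact add_sub_cancel _ _
  · by_cases hq : q = p
    · subst hq
      exact .inr ⟨hψp', hm', hm⟩
    · refine .inl ?_
      filter_upwards [hψq hq] with x hx
      have := ψ.symm_apply_apply x
      rwa [hx] at this

/-- A natural map on jets of Lorentz metrics with values in a bundle of tensors depends only on the
value of the metric. -/
theorem IsNaturalJetMap.eq_of_truncate_eq [T2Space M] {k : ℕ} {σ : Fin k → Index}
    {χ : Jet1 (metricProjection M) → TensorBundle M σ}
    (hχ : IsNaturalJetMap (metricInduction M) (tensorInduction M σ) χ)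
    {u v : Jet1 (metricProjection M)} (h : u.truncate = v.truncate) : χ u = χ v := by
  -- The extra point is the base point of `χ u`, which is not known to be that of `u`.
  obtain ⟨φ, hφ, hq⟩ := exists_diffeomorph_prolong_eq u v h (χ u).1
  rw [← hφ, hχ.2]
  symm
  rcases hq with hq | ⟨h₁, h₂, h₃⟩
  · obtain ⟨O, hO, hOo, hqO⟩ := eventually_nhds_iff.1 hq
    exact (tensorInduction M σ).strongly_consistent φ O hOo hO _ hqO
  · exact TensorialAction.push_eq_self_of_mfderiv _ φ _ h₁ h₂ h₃

end MetricJets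

/-! ### Trivializations of the pulled-back tangent bundle -/

section Pullback

variable {B E F : Type*} [NormedAddCommGroup E] [NormedSpace ℝ E] [NormedAddCommGroup F]
  [NormedSpace ℝ F] {H H' : Type*} [TopologicalSpace H] [TopologicalSpace H']
  {J : ModelWithCorners ℝ F H'} {I : ModelWithCorners ℝ E H} [TopologicalSpace B]
  [ChartedSpace H' B] {M : Type*} [TopologicalSpace M] [ChartedSpace H M] [IsManifold I ∞ M]

/-- Reconciles the coordinates of the jet bundle, which is a Hom bundle out of the pullback of `TM`,
with those in which the derivative of a smooth family of maps is known to be smooth. -/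
theorem symmL_trivializationAt_pullback (f : C^∞⟮J, B; I, M⟯) {b₀ b : B}
    (hb : f b ∈ (chartAt H (f b₀)).source) :
    ((trivializationAt E ((f : B → M) *ᵖ (TangentSpace I : M → Type _)) b₀).symmL ℝ b : E →L[ℝ] E) =
      ((trivializationAt E (TangentSpace I : M → Type _) (f b₀)).symmL ℝ (f b) : E →L[ℝ] E) := by
  ext1 v
  change (trivializationAt E ((f : B → M) *ᵖ (TangentSpace I : M → Type _)) b₀).symmL ℝ b v =
    (trivializationAt E (TangentSpace I : M → Type _) (f b₀)).symmL ℝ (f b) v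
  have hb' : f b ∈ (trivializationAt E (TangentSpace I : M → Type _) (f b₀)).baseSet := hb
  have hb'' : b ∈ (trivializationAt E ((f : B → M) *ᵖ (TangentSpace I : M → Type _)) b₀).baseSet :=
    hb
  rw [Bundle.Trivialization.symmL_apply _ hb'', Bundle.Trivialization.symmL_apply _ hb',
    Bundle.Trivialization.symm_apply _ hb'']
  rfl

end Pullback

/-! ### Smooth local sections of the jet bundle over the bundle of metrics -/

section Sections

variable {M : Type*} [TopologicalSpace M] [ChartedSpace (EuclideanSpace ℝ (Fin 4)) M]
  [IsManifold (𝓡 4) ∞ M]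

/-- The form at `q` that has, in the preferred chart at `p`, the same coordinates as `b`. -/
noncomputable def parallelForm (p : M) (b : MetricBundle M) (q : M) : SymBundle M :=
  (trivializationAt (SymForm (EuclideanSpace ℝ (Fin 4)))
    ((SymForm.action (EuclideanSpace ℝ (Fin 4))).core (𝓡 4) M).Fiber p).toOpenPartialHomeomorph.symm
      (q, fiberCoord p b)

theorem parallelForm_mem (p : M) (b : MetricBundle M) (q : M)
    (h₀ : b.1.1 ∈ (chartAt (EuclideanSpace ℝ (Fin 4)) p).source)
    (hq : q ∈ (chartAt (EuclideanSpace ℝ (Fin 4)) p).source) : parallelForm p b q ∈ MetricBundle M := by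
  set T := tangentBundleCore (𝓡 4) M
  refine (SymForm.isLorentz_pull_iff (g := fiberCoord p b)
    (B := T.coordChange (achart _ q) (achart _ p) q)
    (B' := T.coordChange (achart _ p) (achart _ q) q) ?_ ?_).2 (isLorentz_fiberCoord p b h₀)
  · ext1 v
    exact (T.coordChange_comp _ _ _ _ ⟨⟨hq, mem_chart_source _ _⟩, hq⟩ v).trans
      (T.coordChange_self _ _ hq v)
  · ext1 v
    exact (T.coordChange_comp _ _ _ _ ⟨⟨mem_chart_source _ _, hq⟩, mem_chart_source _ _⟩ v).trans
      (T.coordChange_self _ _ (mem_chart_source _ _) v)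

theorem parallelForm_self (p : M) (b : MetricBundle M)
    (h₀ : b.1.1 ∈ (chartAt (EuclideanSpace ℝ (Fin 4)) p).source) : parallelForm p b b.1.1 = b.1 := by
  set t := trivializationAt (SymForm (EuclideanSpace ℝ (Fin 4)))
    ((SymForm.action (EuclideanSpace ℝ (Fin 4))).core (𝓡 4) M).Fiber p
  exact t.toOpenPartialHomeomorph.left_inv (t.mem_source.2 h₀)

/-- The section through `b` that is constant in the preferred chart at `p`. -/
noncomputable def parallelSection (p : M) (b : MetricBundle M) (q : M) : MetricBundle M :=
  open scoped Classical in
  if h : b.1.1 ∈ (chartAt (EuclideanSpace ℝ (Fin 4)) p).source ∧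
    q ∈ (chartAt (EuclideanSpace ℝ (Fin 4)) p).source then
  ⟨parallelForm p b q, parallelForm_mem p b q h.1 h.2⟩ else b

theorem parallelSection_of_mem {p : M} {b : MetricBundle M} {q : M}
    (h : b.1.1 ∈ (chartAt (EuclideanSpace ℝ (Fin 4)) p).source)
    (hq : q ∈ (chartAt (EuclideanSpace ℝ (Fin 4)) p).source) :
    (parallelSection p b q).1 = parallelForm p b q := by
  rw [parallelSection, dif_pos ⟨h, hq⟩]

/-- The default value `b` off the chart domain makes this hold for every `b`, so that evaluating the
family at its own base point is the identity everywhere. -/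
theorem parallelSection_self (p : M) (b : MetricBundle M) :
    parallelSection p b (metricProjection M b) = b := by
  by_cases h : b.1.1 ∈ (chartAt (EuclideanSpace ℝ (Fin 4)) p).source
  · refine Subtype.ext ?_
    exact (parallelSection_of_mem h h).trans (parallelForm_self p b h)
  · exact dif_neg fun h' => h h'.1

/-- Smoothness is needed jointly in `b` and `q`, because the derivative in `q` is taken at a point
that moves with `b`. The map is a trivialization, a replacement of the base point, and the inverse
trivialization. -/
theorem contMDiffAt_uncurry_parallelSection {p : M} {b : MetricBundle M} {q : M}
    (h : b.1.1 ∈ (chartAt (EuclideanSpace ℝ (Fin 4)) p).source)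
    (hq : q ∈ (chartAt (EuclideanSpace ℝ (Fin 4)) p).source) :
    ContMDiffAt (metricModel.prod (𝓡 4)) metricModel ∞ (Function.uncurry (parallelSection p))
      (b, q) := by
  set t := trivializationAt (SymForm (EuclideanSpace ℝ (Fin 4)))
    ((SymForm.action (EuclideanSpace ℝ (Fin 4))).core (𝓡 4) M).Fiber p
  rw [← ContMDiffAt.subtypeVal_comp_iff]
  have hval : ContMDiff (metricModel.prod (𝓡 4)) metricModel ∞
      (fun x : MetricBundle M × M => x.1.1) := contMDiff_subtype_val.comp contMDiff_fst
  have h₁ : ContMDiffAt (metricModel.prod (𝓡 4)) metricModel ∞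
      (fun x : MetricBundle M × M => t x.1.1) (b, q) :=
    (((Bundle.Trivialization.contMDiffOn (IB := 𝓡 4) (n := ∞) t).contMDiffAt
      (t.open_source.mem_nhds (t.mem_source.2 h))).comp (b, q) hval.contMDiffAt)
  have h₂ : ContMDiffAt (metricModel.prod (𝓡 4)) metricModel ∞
      (fun x : MetricBundle M × M => (x.2, fiberCoord p x.1)) (b, q) :=
    contMDiffAt_snd.prodMk h₁.snd
  have h₃ : ContMDiffAt (metricModel.prod (𝓡 4)) metricModel ∞
      (fun x : MetricBundle M × M => parallelForm p x.1 x.2) (b, q) :=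
    ((Bundle.Trivialization.contMDiffOn_symm (IB := 𝓡 4) (n := ∞) t).contMDiffAt
      (t.open_target.mem_nhds ((t.mem_target (x := (q, fiberCoord p b))).2 hq))).comp (b, q) h₂
  refine h₃.congr_of_eventuallyEq ?_
  have o := (chartAt (EuclideanSpace ℝ (Fin 4)) p).open_source
  have e₁ : ∀ᶠ x : MetricBundle M × M in 𝓝 (b, q),
      x.1.1.1 ∈ (chartAt (EuclideanSpace ℝ (Fin 4)) p).source :=
    ((metricProjection M).contMDiff.continuous.comp continuous_fst).continuousAt.eventually_mem
      (o.mem_nhds h)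
  have e₂ : ∀ᶠ x : MetricBundle M × M in 𝓝 (b, q),
      x.2 ∈ (chartAt (EuclideanSpace ℝ (Fin 4)) p).source :=
    continuous_snd.continuousAt.eventually_mem (o.mem_nhds hq)
  filter_upwards [e₁, e₂] with x hx₁ hx₂
  exact parallelSection_of_mem hx₁ hx₂

theorem isLocalSection_parallelSection {p : M} {b : MetricBundle M}
    (h : b.1.1 ∈ (chartAt (EuclideanSpace ℝ (Fin 4)) p).source) :
    IsLocalSection (metricProjection M) (parallelSection p b) (metricProjection M b) := by
  filter_upwards [(chartAt (EuclideanSpace ℝ (Fin 4)) p).open_source.mem_nhds h] with q hq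
  refine ⟨?_, ?_⟩
  · exact (contMDiffAt_uncurry_parallelSection h hq).comp q
      (contMDiffAt_const.prodMk contMDiffAt_id)
  · change (parallelSection p b q).1.1 = q
    rw [parallelSection_of_mem h hq]; rfl

/-- The 1-jet through `b` of the section that is constant in the preferred chart at `p`. -/
noncomputable def parallelJet (p : M) (b : MetricBundle M) : JetAmbient (metricProjection M) :=
  ⟨b, (mfderiv (𝓡 4) metricModel (parallelSection p b) (metricProjection M b) :
    EuclideanSpace ℝ (Fin 4) →L[ℝ] EuclideanSpace ℝ (Fin 4) × SymForm (EuclideanSpace ℝ (Fin 4)))⟩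

theorem parallelJet_mem {p : M} {b : MetricBundle M}
    (h : b.1.1 ∈ (chartAt (EuclideanSpace ℝ (Fin 4)) p).source) :
    parallelJet p b ∈ jetSet (metricProjection M) :=
  ⟨parallelSection p b, metricProjection M b, isLocalSection_parallelSection h,
    congrArg (fun b' : MetricBundle M => (⟨b', (mfderiv (𝓡 4) metricModel (parallelSection p b)
      (metricProjection M b) : EuclideanSpace ℝ (Fin 4) →L[ℝ]
        EuclideanSpace ℝ (Fin 4) × SymForm (EuclideanSpace ℝ (Fin 4)))⟩ :
          JetAmbient (metricProjection M))) (parallelSection_self p b).symm⟩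

/-- The tangent map of a jointly smooth family depends smoothly on the parameter, here `b`, with the
evaluation point `metricProjection M b` also smooth in `b`. -/
theorem contMDiffAt_parallelJet {p : M} {b : MetricBundle M}
    (h : b.1.1 ∈ (chartAt (EuclideanSpace ℝ (Fin 4)) p).source) :
    ContMDiffAt metricModel (metricModel.prod 𝓘(ℝ, EuclideanSpace ℝ (Fin 4) →L[ℝ]
      EuclideanSpace ℝ (Fin 4) × SymForm (EuclideanSpace ℝ (Fin 4)))) ∞ (parallelJet p) b := by
  rw [contMDiffAt_hom_bundle]
  refine ⟨contMDiffAt_id, ?_⟩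
  have := ContMDiffAt.mfderiv (m := ∞) (n := ∞) (parallelSection p) (metricProjection M)
    (x₀ := b) (contMDiffAt_uncurry_parallelSection h h) (metricProjection M).contMDiff.contMDiffAt
    (by simp)
  have e : (fun x => parallelSection p x (metricProjection M x)) = id :=
    funext (parallelSection_self p)
  rw [e] at this
  refine this.congr_of_eventuallyEq ?_
  have e₁ : ∀ᶠ x : MetricBundle M in 𝓝 b,
      x.1.1 ∈ (chartAt (EuclideanSpace ℝ (Fin 4)) b.1.1).source :=
    (metricProjection M).contMDiff.continuous.continuousAt.eventually_mem
      ((chartAt _ _).open_source.mem_nhds (mem_chart_source _ b.1.1))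
  filter_upwards [e₁] with x hx
  exact congrArg (fun L : EuclideanSpace ℝ (Fin 4) →L[ℝ] EuclideanSpace ℝ (Fin 4) =>
    ((trivializationAt (EuclideanSpace ℝ (Fin 4) × SymForm (EuclideanSpace ℝ (Fin 4)))
      (TangentSpace metricModel : MetricBundle M → Type _) b).continuousLinearMapAt ℝ x).comp
      ((mfderiv (𝓡 4) metricModel (parallelSection p x) (metricProjection M x)).comp L))
    (symmL_trivializationAt_pullback (metricProjection M) hx)

end Sections

/-! ### Descent to the bundle of metrics -/

section Main

variable {M : Type*} [TopologicalSpace M] [ChartedSpace (EuclideanSpace ℝ (Fin 4)) M]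
  [IsManifold (𝓡 4) ∞ M] [T2Space M]

/-- Since `χ` depends only on the value, it may be evaluated on any jet over `b`. Equivariance
follows, as `s (φ b)` and the prolongation of `φ` applied to `s b` have the same value. -/
theorem IsNaturalJetMap.exists_concomitant {k : ℕ} {σ : Fin k → Index}
    {χ : Jet1 (metricProjection M) → TensorBundle M σ}
    (hχ : IsNaturalJetMap (metricInduction M) (tensorInduction M σ) χ) :
    ∃ χ' : MetricBundle M → TensorBundle M σ,
      IsConcomitant (metricInduction M) (tensorInduction M σ) χ' ∧ ∀ u, χ u = χ' u.truncate := by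
  let s : MetricBundle M → Jet1 (metricProjection M) := fun b =>
    ⟨parallelJet b.1.1 b, parallelJet_mem (mem_chart_source _ _)⟩
  have hs : ∀ u, χ u = χ (s u.truncate) := fun u => hχ.eq_of_truncate_eq rfl
  refine ⟨fun b => χ (s b), ⟨fun b₀ => ?_, fun φ b => ?_⟩, hs⟩
  -- The chart used by `s` jumps with the base point, so `s` need not be smooth. Near `b₀` it is
  -- replaced by the jets parallel in the fixed chart at the base point of `b₀`, on which `χ` takes
  -- the same values.
  · obtain ⟨U, F, hU, hbU, hF, hχF⟩ := hχ.1 (s b₀)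
    have hj := contMDiffAt_parallelJet (p := b₀.1.1) (b := b₀) (mem_chart_source _ _)
    refine ((hF.contMDiffAt (hU.mem_nhds hbU)).comp b₀ hj).congr_of_eventuallyEq ?_
    have e₁ : ∀ᶠ b : MetricBundle M in 𝓝 b₀,
        b.1.1 ∈ (chartAt (EuclideanSpace ℝ (Fin 4)) b₀.1.1).source :=
      (metricProjection M).contMDiff.continuous.continuousAt.eventually_mem
        ((chartAt _ _).open_source.mem_nhds (mem_chart_source _ b₀.1.1))
    filter_upwards [e₁, hj.continuousAt.eventually_mem (hU.mem_nhds hbU)] with b hb hbU'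
    exact (hχ.eq_of_truncate_eq (u := s b) (v := ⟨parallelJet b₀.1.1 b, parallelJet_mem hb⟩) rfl).trans
      (hχF ⟨parallelJet b₀.1.1 b, parallelJet_mem hb⟩ hbU')
  · rw [← hχ.2]
    exact hχ.eq_of_truncate_eq rfl

end Main

end Concomitant

theorem mainTheorem7 (M : Type*) [TopologicalSpace M]
    [ChartedSpace (EuclideanSpace ℝ (Fin 4)) M] [IsManifold (𝓡 4) ∞ M] [T2Space M]
    [ParacompactSpace M] [ConnectedSpace M] {k : ℕ} (σ : Fin k → Concomitant.Index) :
    (¬ ∃ χ : Concomitant.Jet1 (Concomitant.metricProjection M) → Concomitant.TensorBundle M σ,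
      Concomitant.IsFirstOrderConcomitant (Concomitant.metricInduction M)
        (Concomitant.tensorInduction M σ) χ) ∧
    ∀ χ : Concomitant.Jet1 (Concomitant.metricProjection M) → Concomitant.TensorBundle M σ,
      Concomitant.IsNaturalJetMap (Concomitant.metricInduction M)
        (Concomitant.tensorInduction M σ) χ →
      ∃ χ' : Concomitant.MetricBundle M → Concomitant.TensorBundle M σ,
        Concomitant.IsConcomitant (Concomitant.metricInduction M)
          (Concomitant.tensorInduction M σ) χ' ∧ ∀ u, χ u = χ' u.truncate :=
  ⟨fun ⟨_, hχ, h⟩ => h hχ.exists_concomitant, fun _ hχ => hχ.exists_concomitant⟩
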